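/- Let $d\ge 1$, $j\in\{1,\dots,d\}$, and let $\alpha\in\mathbb R^d$ satisfy $\alpha_j>-3/2$ and $\alpha_i>-1$ for $i\ne j$. On $\mathbb R_+^d=(0,\infty)^d$ let $$dm_\alpha(x)=\Big(\prod_{i=1}^d x_i^{\alpha_i}e^{-x_i}\Big)dx .$$ For $\beta\in(-1,\infty)^d$ and $k\in\mathbb N^d$ ($\mathbb N=\{0,1,2,\dots\}$) put $\widehat L_k^\beta(x)=\prod_{i=1}^d\big(\tfrac{\Gamma(k_i+1)}{\Gamma(k_i+\beta_i+1)}\big)^{1/2}L_{k_i}^{\beta_i}(x_i)$, where $L_n^{b}$ is the Laguerre polynomial of degree $n$ and order $b$, and let $$G_t^{\beta,\widehat L}(x,y)=\sum_{n=0}^\infty e^{-tn}\sum_{|k|=n}\widehat L_k^\beta(x)\widehat L_k^\beta(y),\qquad t>0,\ x,y\in\mathbb R^d_+,\quad |k|=k_1+\dots+k_d .$$ The modified Laguerre polynomial semigroup is given by $\widetilde T_0^{\alpha,\widehat L,j}=\mathrm{Id}$ and, for $t>0$, $$\widetilde T_t^{\alpha,\widehat L,j}f(x)=e^{-t}\int_{\mathbb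 R^d_+}\sqrt{x_jy_j}\,G_t^{\alpha+e_j,\widehat L}(x,y)f(y)\,dm_\alpha(y),\qquad x\in\mathbb R_+^d,$$ where $e_j$ is the $j$th coordinate vector. The functions $f$ are real- or complex-valued, and $L^p=L^p(\mathbb R^d_+,m_\alpha)$. A *symmetric diffusion semigroup* is a family $\{T_t\}_{t\ge0}$ of linear operators from $L^1+L^\infty$ to measurable functions with $T_0=\mathrm{Id}$ such that (i) for each $1\le p\le\infty$ every $T_t$ is a contraction on $L^p$ and $\{T_t\}$ is a semigroup there; (ii) each $T_t$ is self-adjoint on $L^2$; (iii) $\lim_{t\to0^+}T_tf=f$ in $L^2$ for each $f\in L^2$. It is *submarkovian* (respectively *Markovian*) if moreover $T_tf\ge0$ whenever $f\ge0$, and $T_t\mathbf 1\le\mathbf 1$ (respectively $T_t\mathbf 1=\mathbf 1$) for all $t$. A family $\{T_t\}$ is *$L^p$-contractive* if $\|T_tf\|_p\le\|f\|_p$ for all $1\le p\le\infty$, $t\ge0$ and $f\in L^2\cap L^p$. **Proposition.** For every $f\in L^1+L^\infty$, $t>0$ and $x\in\mathbb R^d_+$ the integral defining $\widetilde T_t^{\alpha,\widehat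 L,j}f(x)$ converges absolutely. Moreover: 1. If $\alpha_j\ge-1/2$, then $\{\widetilde T_t^{\alpha,\widehat L,j}\}$ is a submarkovian (but not Markovian) symmetric diffusion semigroup, and for each $1\le p\le\infty$ $$\|\widetilde T_t^{\alpha,\widehat L,j}\|_{p\to p}\le e^{-t/2},\qquad t>0.$$ 2. If $\alpha_j<-1/2$, then $\{\widetilde T_t^{\alpha,\widehat L,j}\}$ is not $L^p$-contractive (that is, the inequality above fails for some $p\in[1,\infty]$, $t\ge 0$ and $f\in L^2\cap L^p$), but there is a constant $c=c(\alpha)>1$ such that for each $1\le p\le\infty$ $$\|\widetilde T_t^{\alpha,\widehat L,j}\|_{p\to p}\le c\,e^{-t/2},\qquad t>0.$$ -/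

import Mathlib

open MeasureTheory Filter Topology
open scoped ENNReal ComplexOrder

noncomputable section

/-! ### Symmetric diffusion semigroups

Operators act on functions `X → 𝕜`; all statements are up to `μ`-a.e. equality.
The index `t` of a family `T : ℝ → (X → 𝕜) → (X → 𝕜)` is used for `0 ≤ t` only. -/

section Semigroups

variable {X : Type*} [MeasurableSpace X] {𝕜 : Type*} [RCLike 𝕜]

/-- The space `L¹(μ) + L^∞(μ)`. -/
def InL1AddLinfty (μ : Measure X) (f : X → 𝕜) : Prop :=
  ∃ g h : X → 𝕜, MemLp g 1 μ ∧ MemLp h ∞ μ ∧ f = g + h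

/-- `A` maps `L^p(μ)` into itself and `‖A‖_{p → p} ≤ B`. -/
def LpNormLE (μ : Measure X) (A : (X → 𝕜) → (X → 𝕜)) (p : ℝ≥0∞) (B : ℝ) : Prop :=
  ∀ f : X → 𝕜, MemLp f p μ →
    MemLp (A f) p μ ∧ eLpNorm (A f) p μ ≤ ENNReal.ofReal B * eLpNorm f p μ

/-- `A` is a linear operator from `L¹(μ) + L^∞(μ)` to the space of (a.e. classes of)
measurable functions. -/
structure IsLinearOnL1AddLinfty (μ : Measure X) (A : (X → 𝕜) → (X → 𝕜)) : Prop where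
  measurable : ∀ f, InL1AddLinfty μ f → AEStronglyMeasurable (A f) μ
  congr : ∀ f g, InL1AddLinfty μ f → InL1AddLinfty μ g → f =ᵐ[μ] g → A f =ᵐ[μ] A g
  add : ∀ f g, InL1AddLinfty μ f → InL1AddLinfty μ g → A (f + g) =ᵐ[μ] A f + A g
  smul : ∀ (c : 𝕜) (f), InL1AddLinfty μ f → A (c • f) =ᵐ[μ] c • A f

/-- Symmetric diffusion semigroups, with domain `L¹(μ) + L^∞(μ)`. -/
structure IsSymmetricDiffusionSemigroup (μ : Measure X) (T : ℝ → (X → 𝕜) → (X → 𝕜)) :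
    Prop where
  linear : ∀ t, 0 ≤ t → IsLinearOnL1AddLinfty μ (T t)
  zero : ∀ f, InL1AddLinfty μ f → T 0 f =ᵐ[μ] f
  contraction : ∀ p : ℝ≥0∞, 1 ≤ p → ∀ t, 0 ≤ t → LpNormLE μ (T t) p 1
  semigroup : ∀ p : ℝ≥0∞, 1 ≤ p → ∀ s t, 0 ≤ s → 0 ≤ t →
    ∀ f, MemLp f p μ → T (s + t) f =ᵐ[μ] T s (T t f)
  selfAdjoint : ∀ t, 0 ≤ t → ∀ f g, MemLp f 2 μ → MemLp g 2 μ →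
    ∫ x, inner 𝕜 (T t f x) (g x) ∂μ = ∫ x, inner 𝕜 (f x) (T t g x) ∂μ
  continuous : ∀ f, MemLp f 2 μ →
    Tendsto (fun t => eLpNorm (T t f - f) 2 μ) (𝓝[>] 0) (𝓝 0)

/-- `T_t f ≥ 0` whenever `f ≥ 0`. -/
def IsPositiveFamily (μ : Measure X) (T : ℝ → (X → 𝕜) → (X → 𝕜)) : Prop :=
  ∀ t, 0 ≤ t → ∀ f, InL1AddLinfty μ f → (∀ᵐ x ∂μ, 0 ≤ f x) → ∀ᵐ x ∂μ, 0 ≤ T t f x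

/-- Markovian symmetric diffusion semigroups: positive and `T_t 1 = 1`. -/
def IsMarkovian (μ : Measure X) (T : ℝ → (X → 𝕜) → (X → 𝕜)) : Prop :=
  IsSymmetricDiffusionSemigroup μ T ∧ IsPositiveFamily μ T ∧
    ∀ t, 0 ≤ t → ∀ᵐ x ∂μ, T t (fun _ => 1) x = 1

/-- Submarkovian symmetric diffusion semigroups: positive and `T_t 1 ≤ 1`. -/
def IsSubmarkovian (μ : Measure X) (T : ℝ → (X → 𝕜) → (X → 𝕜)) : Prop :=
  IsSymmetricDiffusionSemigroup μ T ∧ IsPositiveFamily μ T ∧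
    ∀ t, 0 ≤ t → ∀ᵐ x ∂μ, T t (fun _ => 1) x ≤ 1

/-- `L^p`-contractivity: `‖T_t f‖_p ≤ ‖f‖_p` for all `1 ≤ p ≤ ∞`, `t ≥ 0`, `f ∈ L² ∩ L^p`. -/
def IsLpContractive (μ : Measure X) (T : ℝ → (X → 𝕜) → (X → 𝕜)) : Prop :=
  ∀ p : ℝ≥0∞, 1 ≤ p → ∀ t, 0 ≤ t → ∀ f, MemLp f 2 μ → MemLp f p μ →
    eLpNorm (T t f) p μ ≤ eLpNorm f p μ

end Semigroups

/-! ### Laguerre polynomials and the modified Laguerre semigroup -/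

/-- The Laguerre polynomial `L_n^a(x)` of degree `n` and order `a > -1`. -/
def laguerre (n : ℕ) (a x : ℝ) : ℝ :=
  ∑ m ∈ Finset.range (n + 1),
    Real.Gamma (n + a + 1) / (Real.Gamma (m + a + 1) * (n - m).factorial * m.factorial) *
      (-x) ^ m

/-- The normalized Laguerre polynomial
`(Γ(n + 1) / Γ(n + a + 1))^{1/2} L_n^a(x)`. -/
def normLaguerre (n : ℕ) (a x : ℝ) : ℝ :=
  Real.sqrt (Real.Gamma (n + 1) / Real.Gamma (n + a + 1)) * laguerre n a x

variable {d : ℕ}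

/-- The open orthant `(0, ∞)^d`. -/
def posOrthant (d : ℕ) : Set (Fin d → ℝ) := {x | ∀ i, 0 < x i}

/-- Tensor products of normalized Laguerre polynomials. -/
def normLaguerreProd (k : Fin d → ℕ) (α x : Fin d → ℝ) : ℝ :=
  ∏ i, normLaguerre (k i) (α i) (x i)

/-- The measure `dm_α(x) = ∏ x_i^{α_i} e^{-x_i} dx` on `(0, ∞)^d`. -/
def laguerreMeasure (α : Fin d → ℝ) : Measure (Fin d → ℝ) :=
  (volume.restrict (posOrthant d)).withDensity
    fun x => ENNReal.ofReal (∏ i, x i ^ α i * Real.exp (-x i))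

/-- The heat kernel `∑_n e^{-tn} ∑_{|k| = n} L̂_k^α(x) L̂_k^α(y)` of the Laguerre polynomial
semigroup. -/
def laguerreHeatKernel (α : Fin d → ℝ) (t : ℝ) (x y : Fin d → ℝ) : ℝ :=
  ∑' n : ℕ, Real.exp (-t * n) *
    ∑ k ∈ Finset.piAntidiag (Finset.univ : Finset (Fin d)) n,
      normLaguerreProd k α x * normLaguerreProd k α y

/-- The kernel `e^{-t} (x_j y_j)^{1/2} G_t^{α + e_j}(x, y)` (with respect to `m_α`). -/
def modifiedKernel (α : Fin d → ℝ) (j : Fin d) (t : ℝ) (x y : Fin d → ℝ) : ℝ :=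
  Real.exp (-t) * (Real.sqrt (x j * y j) * laguerreHeatKernel (α + Pi.single j 1) t x y)

/-- The modified Laguerre polynomial semigroup, with `T_0 = Id`. -/
def modifiedSemigroup (𝕜 : Type*) [RCLike 𝕜] (α : Fin d → ℝ) (j : Fin d) (t : ℝ)
    (f : (Fin d → ℝ) → 𝕜) : (Fin d → ℝ) → 𝕜 :=
  if t = 0 then f
  else fun x => ∫ y, (modifiedKernel α j t x y : 𝕜) * f y ∂(laguerreMeasure α)

/-- The admissible parameters: `α_j > -3/2` and `α_i > -1` for `i ≠ j`. -/
def IsAdmissible (α : Fin d → ℝ) (j : Fin d) : Prop :=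
  -3 / 2 < α j ∧ ∀ i, i ≠ j → -1 < α i

end

/-!
Write `r = e^{-t}`. The Hille–Hardy formula sums the Laguerre heat kernel to a product of
one-dimensional Mehler kernels, each a positive factor times a Bessel series with positive
coefficients. The modified kernel is `r √(x_j y_j)` times the heat kernel of order `α + e_j`, so
it is positive and symmetric, and it inherits the semigroup law from the heat kernels of that
order. Strong continuity holds because the Mehler kernels have mass `1` and their second moments
about `x` vanish as `r → 1`.

By Schur's test all the norm bounds reduce to the total mass of the modified kernel. The
coordinates `i ≠ j` contribute `1` to it, and the `j`-th coordinate contributes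
`√r · E[(1 - V)^c]`, where `c = α_j + 1/2`, the expectation is over `V < 1`, and `V` has the Gamma
distribution with shape `1/2` and rate `z = r x_j / (1 - r)`. For `c ≥ 0` the expectation is at
most `1`. For `-1 < c < 0` it is bounded, but since `(1 - V)^c ≥ 1 + |c| V` outweighs the
exponentially small probability of `V ≥ 1`, it exceeds some `κ > 1` for `z` in an interval. As soon
as `√r κ > 1`, the semigroup applied to an approximation of `1` by indicator functions violates
contractivity on `L^∞`.
-/

open Finset.HasAntidiagonal (antidiagonal mem_antidiagonal)

/-! ### Sums over fibers, power series and binomial shifts -/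

theorem hasSum_sum_fiber {ι κ E : Type*} [AddCommMonoid E] [TopologicalSpace E] [ContinuousAdd E]
    [RegularSpace E] {g : ι → κ} {s : κ → Finset ι} (hs : ∀ k i, i ∈ s k ↔ g i = k)
    {f : ι → E} {S : E} (h : HasSum f S) : HasSum (fun k => ∑ i ∈ s k, f i) S :=
  ((Equiv.sigmaFiberEquiv g).hasSum_iff.2 h).sigma fun k =>
    (Equiv.subtypeEquivRight (hs k)).hasSum_iff.1 ((s k).hasSum f)

theorem summable_of_summable_sum_fiber {ι κ : Type*} {g : ι → κ} {s : κ → Finset ι}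
    (hs : ∀ k i, i ∈ s k ↔ g i = k) {f : ι → ℝ} (hf : ∀ i, 0 ≤ f i)
    (h : Summable fun k => ∑ i ∈ s k, f i) : Summable f := by
  have hfiber : ∀ k, HasSum (fun i : {i // g i = k} => f i) (∑ i ∈ s k, f i) := fun k =>
    (Equiv.subtypeEquivRight (hs k)).hasSum_iff.1 ((s k).hasSum f)
  rw [← (Equiv.sigmaFiberEquiv g).summable_iff]
  exact (summable_sigma_of_nonneg fun _ => hf _).2
    ⟨fun k => (hfiber k).summable, h.congr fun k => (hfiber k).tsum_eq.symm⟩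

theorem hasSum_sum_antidiagonal {E : Type*} [AddCommMonoid E] [TopologicalSpace E]
    [ContinuousAdd E] [RegularSpace E] {f : ℕ × ℕ → E} {S : E} (h : HasSum f S) :
    HasSum (fun n => ∑ p ∈ antidiagonal n, f p) S :=
  hasSum_sum_fiber (fun _ _ => mem_antidiagonal) h

theorem summable_of_summable_sum_antidiagonal {f : ℕ × ℕ → ℝ} (hf : ∀ p, 0 ≤ f p)
    (h : Summable fun n => ∑ p ∈ antidiagonal n, f p) : Summable f :=
  summable_of_summable_sum_fiber (fun _ _ => mem_antidiagonal) hf h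

theorem eq_of_eventually_hasSum_mul_pow {𝕜 : Type*} [NontriviallyNormedField 𝕜] {c c' : ℕ → 𝕜}
    {f : 𝕜 → 𝕜} (h : ∀ᶠ z in 𝓝 0, HasSum (fun n => c n * z ^ n) (f z))
    (h' : ∀ᶠ z in 𝓝 0, HasSum (fun n => c' n * z ^ n) (f z)) : c = c' := by
  have hseries : ∀ b : ℕ → 𝕜, (∀ᶠ z in 𝓝 0, HasSum (fun n => b n * z ^ n) (f z)) →
      HasFPowerSeriesAt f (FormalMultilinearSeries.ofScalars 𝕜 b) 0 := fun b hb => by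
    rw [hasFPowerSeriesAt_iff]
    simpa only [FormalMultilinearSeries.coeff_ofScalars, smul_eq_mul, zero_add, mul_comm]
      using hb
  exact FormalMultilinearSeries.ofScalars_series_injective 𝕜 𝕜
    ((hseries c h).eq_formalMultilinearSeries (hseries c' h'))

theorem add_pow_eq_sum_antidiagonal {R : Type*} [CommSemiring R] (x y : R) (n : ℕ) :
    (x + y) ^ n =
      ∑ p ∈ antidiagonal n, ((p.2 + p.1).choose p.1 : R) * y ^ p.2 * x ^ p.1 := by
  rw [(Commute.all x y).add_pow']
  refine Finset.sum_congr rfl fun p hp => ?_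
  rw [← mem_antidiagonal.1 hp, nsmul_eq_mul, add_comm p.1]
  ring

theorem summable_binomial_shift {c : ℕ → ℝ} {r s : ℝ}
    (h : Summable fun n => |c n| * (|s| + |r|) ^ n) :
    Summable fun p : ℕ × ℕ =>
      ((p.2 + p.1).choose p.1 : ℝ) * r ^ p.2 * c (p.2 + p.1) * s ^ p.1 := by
  rw [← summable_abs_iff]
  refine summable_of_summable_sum_antidiagonal (fun _ => abs_nonneg _) (h.congr fun n => ?_)
  rw [add_pow_eq_sum_antidiagonal, Finset.mul_sum]
  refine Finset.sum_congr rfl fun p hp => ?_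
  rw [← mem_antidiagonal.1 hp, add_comm p.1]
  simp only [abs_mul, abs_pow, Nat.abs_cast]
  ring

theorem summable_choose_mul {c : ℕ → ℝ} {r s : ℝ} (hs : s ≠ 0)
    (h : Summable fun n => |c n| * (|s| + |r|) ^ n) (m : ℕ) :
    Summable fun l => ((l + m).choose m : ℝ) * r ^ l * c (l + m) :=
  (summable_mul_right_iff (pow_ne_zero m hs)).1 ((summable_binomial_shift h).prod_factor m)

theorem hasSum_binomial_shift {c C : ℕ → ℝ} {r s S : ℝ}
    (h : Summable fun n => |c n| * (|s| + |r|) ^ n)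
    (hC : ∀ m, HasSum (fun l => ((l + m).choose m : ℝ) * r ^ l * c (l + m)) (C m))
    (hS : HasSum (fun n => c n * (s + r) ^ n) S) : HasSum (fun m => C m * s ^ m) S := by
  have hp := (summable_binomial_shift h).hasSum
  have hsum_eq : S = ∑' p : ℕ × ℕ,
      ((p.2 + p.1).choose p.1 : ℝ) * r ^ p.2 * c (p.2 + p.1) * s ^ p.1 := by
    refine hS.unique ((hasSum_sum_antidiagonal hp).congr_fun fun n => ?_)
    rw [add_pow_eq_sum_antidiagonal, Finset.mul_sum]
    refine Finset.sum_congr rfl fun p hp => ?_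
    rw [← mem_antidiagonal.1 hp, add_comm p.1]
    ring
  rw [hsum_eq]
  exact hp.prod_fiberwise fun m => (hC m).mul_right (s ^ m)

/-! ### Gamma quotients and Bessel series -/

theorem Gamma_add_natCast {s : ℝ} (hs : 0 < s) (n : ℕ) :
    Real.Gamma (s + n) = (ascPochhammer ℝ n).eval s * Real.Gamma s := by
  induction n with
  | zero => simp
  | succ n ih =>
    rw [ascPochhammer_succ_eval, Nat.cast_succ, ← add_assoc,
      Real.Gamma_add_one (by positivity), ih]
    ring

theorem Gamma_natCast_add_pos {a : ℝ} (ha : -1 < a) (m : ℕ) : 0 < Real.Gamma (m + a + 1) :=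
  Real.Gamma_pos_of_pos (by linarith [m.cast_nonneg (α := ℝ)])

theorem factorial_mul_choose_eq_ascPochhammer_eval (b : ℝ) (n : ℕ) :
    n.factorial * Ring.choose (b + n - 1) n = (ascPochhammer ℝ n).eval b := by
  rw [← Polynomial.ascPochhammer_smeval_eq_eval,
    ← Ring.factorial_nsmul_multichoose_eq_ascPochhammer, nsmul_eq_mul, Ring.choose,
    show b + n - 1 - n + 1 = b by ring]

theorem hasSum_one_sub_rpow_neg {b s : ℝ} (hb : 0 < b) (hs : |s| < 1) :
    HasSum (fun n : ℕ => Real.Gamma (b + n) / (Real.Gamma b * n.factorial) * s ^ n)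
      ((1 - s) ^ (-b)) := by
  have h := (Real.one_div_one_sub_rpow_hasFPowerSeriesOnBall_zero b).hasSum (y := s)
    (by simpa [enorm_eq_nnnorm, ← NNReal.coe_lt_coe] using hs)
  rw [zero_add, one_div, ← Real.rpow_neg (by linarith [(abs_lt.1 hs).2])] at h
  refine h.congr_fun fun n => ?_
  have := (Real.Gamma_pos_of_pos hb).ne'
  rw [FormalMultilinearSeries.ofScalars_apply_eq, smul_eq_mul, Gamma_add_natCast hb,
    ← factorial_mul_choose_eq_ascPochhammer_eval]
  field_simp

theorem hasSum_pow_div_factorial (x : ℝ) :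
    HasSum (fun n : ℕ => x ^ n / n.factorial) (Real.exp x) := by
  rw [Real.exp_eq_exp_ℝ]
  exact NormedSpace.expSeries_div_hasSum_exp x

theorem factorial_mul_Gamma_le {a : ℝ} (ha : -1 < a) (m : ℕ) :
    m.factorial * Real.Gamma (a + 2) ≤ Real.Gamma (m + a + 2) := by
  induction m with
  | zero => simp
  | succ n ih =>
    have : (0 : ℝ) ≤ n := n.cast_nonneg
    have hΓ : 0 < Real.Gamma (a + 2) := Real.Gamma_pos_of_pos (by linarith)
    rw [show ((n + 1 : ℕ) : ℝ) + a + 2 = (n + a + 2) + 1 by push_cast; ring,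
      Real.Gamma_add_one (by linarith), Nat.factorial_succ, Nat.cast_mul, mul_assoc]
    exact mul_le_mul (by push_cast; linarith) ih (by positivity) (by linarith)

theorem exists_pow_div_Gamma_le {a D : ℝ} (ha : -1 < a) (hD : 0 ≤ D) :
    ∃ C, 0 < C ∧ ∀ m : ℕ, D ^ m / Real.Gamma (m + a + 1) ≤ C := by
  have h1 : 0 < Real.Gamma (a + 1) := Real.Gamma_pos_of_pos (by linarith)
  have h2 : 0 < Real.Gamma (a + 2) := Real.Gamma_pos_of_pos (by linarith)
  refine ⟨1 / Real.Gamma (a + 1) + D * Real.exp D / Real.Gamma (a + 2), by positivity, ?_⟩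
  rintro (_ | m)
  · simp only [pow_zero, Nat.cast_zero, zero_add]
    exact le_add_of_nonneg_right (by positivity)
  · refine le_trans ?_ (le_add_of_nonneg_left (by positivity))
    rw [show ((m + 1 : ℕ) : ℝ) + a + 1 = m + a + 2 by push_cast; ring, pow_succ']
    calc D * D ^ m / Real.Gamma (m + a + 2)
        ≤ D * D ^ m / (m.factorial * Real.Gamma (a + 2)) := by
          gcongr
          exact factorial_mul_Gamma_le ha m
      _ = D * (D ^ m / m.factorial) / Real.Gamma (a + 2) := by field_simp
      _ ≤ D * Real.exp D / Real.Gamma (a + 2) := by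
          gcongr
          exact le_hasSum (hasSum_pow_div_factorial D) m fun j _ => by positivity

/-- The entire function `∑ w^m / (m! Γ(m + a + 1))`, that is `w^{-a/2} I_a(2√w)` for the modified
Bessel function `I_a`. -/
noncomputable def besselSeries (a w : ℝ) : ℝ :=
  ∑' m : ℕ, w ^ m / (m.factorial * Real.Gamma (m + a + 1))

theorem hasSum_besselSeries {a : ℝ} (ha : -1 < a) (w : ℝ) :
    HasSum (fun m : ℕ => w ^ m / (m.factorial * Real.Gamma (m + a + 1))) (besselSeries a w) := by
  obtain ⟨C, _, h⟩ := exists_pow_div_Gamma_le ha (abs_nonneg w)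
  refine (Summable.of_norm_bounded ((hasSum_pow_div_factorial 1).summable.mul_left C)
    fun m => ?_).hasSum
  have hΓ := Gamma_natCast_add_pos ha m
  calc ‖w ^ m / (m.factorial * Real.Gamma (m + a + 1))‖
      = |w| ^ m / Real.Gamma (m + a + 1) * (1 / m.factorial) := by
        rw [Real.norm_eq_abs, abs_div, abs_pow, abs_mul, Nat.abs_cast, abs_of_pos hΓ]
        field_simp
    _ ≤ C * (1 ^ m / m.factorial) := by
        rw [one_pow]
        gcongr
        exact h m

/-! ### Generating functions of Laguerre polynomials -/

/-- The coefficient of `(-x)^k` in the Laguerre polynomial `L_{k+j}^a(x)`. Indexing by `(k, j)`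
turns the generating functions into double series summed over antidiagonals. -/
noncomputable def laguerreCoeff (a : ℝ) (k j : ℕ) : ℝ :=
  Real.Gamma (k + j + a + 1) / (Real.Gamma (k + a + 1) * j.factorial * k.factorial)

theorem laguerre_eq_sum_laguerreCoeff (n : ℕ) (a x : ℝ) :
    laguerre n a x = ∑ p ∈ antidiagonal n, laguerreCoeff a p.1 p.2 * (-x) ^ p.1 := by
  rw [Finset.Nat.sum_antidiagonal_eq_sum_range_succ fun k j => laguerreCoeff a k j * (-x) ^ k]
  refine Finset.sum_congr rfl fun m hm => ?_
  rw [laguerreCoeff, ← Nat.cast_add, Nat.add_sub_cancel' (Finset.mem_range_succ_iff.1 hm)]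

section

variable {a : ℝ} (ha : -1 < a)
include ha

theorem laguerreCoeff_pos (k j : ℕ) : 0 < laguerreCoeff a k j := by
  have h₁ := Gamma_natCast_add_pos ha k
  have h₂ := Gamma_natCast_add_pos ha (k + j)
  rw [Nat.cast_add] at h₂
  unfold laguerreCoeff
  positivity

theorem hasSum_laguerreCoeff_mul_pow (x : ℝ) {s : ℝ} (hs : |s| < 1) (k : ℕ) :
    HasSum (fun j => laguerreCoeff a k j * (-x) ^ k * s ^ (k + j))
      ((1 - s) ^ (-a - 1) * ((-(s * x / (1 - s))) ^ k / k.factorial)) := by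
  have hs1 : 0 < 1 - s := by linarith [(abs_lt.1 hs).2]
  have hk : (0 : ℝ) < k + a + 1 := by linarith [k.cast_nonneg (α := ℝ)]
  convert! (hasSum_one_sub_rpow_neg hk hs).mul_left ((-x * s) ^ k / k.factorial) using 1
  · ext j
    have := (Gamma_natCast_add_pos ha k).ne'
    rw [laguerreCoeff, show (k : ℝ) + j + a + 1 = k + a + 1 + j by ring, pow_add, mul_pow]
    field_simp
  · rw [show -((k : ℝ) + a + 1) = (-a - 1) - k by ring, Real.rpow_sub hs1 (-a - 1) k,
      Real.rpow_natCast, show -(s * x / (1 - s)) = -x * s / (1 - s) by ring, div_pow]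
    ring

theorem summable_laguerreCoeff_mul_pow (x : ℝ) {s : ℝ} (hs : |s| < 1) :
    Summable fun p : ℕ × ℕ => laguerreCoeff a p.1 p.2 * (-x) ^ p.1 * s ^ (p.1 + p.2) := by
  have hfiber : ∀ k, HasSum (fun j => |laguerreCoeff a k j * (-x) ^ k * s ^ (k + j)|)
      ((1 - |s|) ^ (-a - 1) * ((-(|s| * -|x| / (1 - |s|))) ^ k / k.factorial)) := fun k => by
    refine (hasSum_laguerreCoeff_mul_pow ha (-|x|) (by rwa [abs_abs]) k).congr_fun fun j => ?_
    simp only [abs_mul, abs_pow, abs_neg, neg_neg, abs_of_pos (laguerreCoeff_pos ha k j)]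
  rw [← summable_abs_iff, summable_prod_of_nonneg fun _ => abs_nonneg _]
  exact ⟨fun k => (hfiber k).summable, (((hasSum_pow_div_factorial _).mul_left _).summable).congr
    fun k => (hfiber k).tsum_eq.symm⟩

theorem hasSum_laguerre_mul_pow (x : ℝ) {s : ℝ} (hs : |s| < 1) :
    HasSum (fun n => laguerre n a x * s ^ n)
      ((1 - s) ^ (-a - 1) * Real.exp (-(s * x / (1 - s)))) := by
  have hsum := (summable_laguerreCoeff_mul_pow ha x hs).hasSum
  rw [(hsum.prod_fiberwise (hasSum_laguerreCoeff_mul_pow ha x hs)).unique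
    ((hasSum_pow_div_factorial _).mul_left _)] at hsum
  refine (hasSum_sum_antidiagonal hsum).congr_fun fun n => ?_
  rw [laguerre_eq_sum_laguerreCoeff, Finset.sum_mul]
  exact Finset.sum_congr rfl fun p hp => by rw [mem_antidiagonal.1 hp]

theorem summable_abs_laguerre_mul_pow (x : ℝ) {s : ℝ} (hs0 : 0 ≤ s) (hs : s < 1) :
    Summable fun n => |laguerre n a x| * s ^ n :=
  (hasSum_laguerre_mul_pow ha x (by rwa [abs_of_nonneg hs0])).summable.abs.congr fun n => by
    rw [abs_mul, abs_of_nonneg (pow_nonneg hs0 n)]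

theorem hasSum_laguerre_div_one_sub_mul_pow (x : ℝ) {r s : ℝ} (hs : |s| < 1 - r) :
    HasSum (fun m => (1 - r) ^ (-a - 1) * Real.exp (-(r * x / (1 - r))) *
        (laguerre m a (x / (1 - r)) / (1 - r) ^ m) * s ^ m)
      ((1 - (s + r)) ^ (-a - 1) * Real.exp (-((s + r) * x / (1 - (s + r))))) := by
  have h1r : 0 < 1 - r := (abs_nonneg s).trans_lt hs
  have hpos : 0 < 1 - (s + r) := by linarith [(abs_lt.1 hs).2]
  have hsub : 1 - s / (1 - r) = (1 - (s + r)) / (1 - r) := by field_simp; ring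
  have hexp : -((s + r) * x / (1 - (s + r))) = -(r * x / (1 - r)) +
      -(s / (1 - r) * (x / (1 - r)) / ((1 - (s + r)) / (1 - r))) := by
    field_simp
    ring
  have hsum := (hasSum_laguerre_mul_pow ha (x / (1 - r)) (s := s / (1 - r))
    (by rwa [abs_div, abs_of_pos h1r, div_lt_one h1r])).mul_left
    ((1 - r) ^ (-a - 1) * Real.exp (-(r * x / (1 - r))))
  rw [hsub, Real.div_rpow hpos.le h1r.le] at hsum
  convert! hsum using 1
  · ext m
    rw [div_pow]
    ring
  · rw [hexp, Real.exp_add]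
    have := (Real.rpow_pos_of_pos h1r (-a - 1)).ne'
    field_simp

theorem hasSum_choose_mul_laguerre (x : ℝ) {r : ℝ} (hr0 : 0 ≤ r) (hr : r < 1) (m : ℕ) :
    HasSum (fun l => ((l + m).choose m : ℝ) * r ^ l * laguerre (l + m) a x)
      ((1 - r) ^ (-a - 1) * Real.exp (-(r * x / (1 - r))) *
        (laguerre m a (x / (1 - r)) / (1 - r) ^ m)) := by
  have h1r : 0 < 1 - r := by linarith
  have hnear : ∀ᶠ s : ℝ in 𝓝 0, |s| < 1 - r :=
    (continuous_abs.tendsto' (0 : ℝ) 0 abs_zero).eventually_lt_const h1r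
  have hsummable : ∀ s, |s| < 1 - r → Summable fun n => |laguerre n a x| * (|s| + |r|) ^ n :=
    fun s hs => summable_abs_laguerre_mul_pow ha x (by positivity)
      (by rw [abs_of_nonneg hr0]; linarith)
  have hinner : ∀ m, Summable fun l => ((l + m).choose m : ℝ) * r ^ l * laguerre (l + m) a x :=
    summable_choose_mul (c := fun n => laguerre n a x) (half_pos h1r).ne'
      (hsummable _ (by rw [abs_of_pos (half_pos h1r)]; linarith))
  have hshift : ∀ᶠ s in 𝓝 0, HasSum
      (fun m => (∑' l, ((l + m).choose m : ℝ) * r ^ l * laguerre (l + m) a x) * s ^ m)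
      ((1 - (s + r)) ^ (-a - 1) * Real.exp (-((s + r) * x / (1 - (s + r))))) :=
    hnear.mono fun s hs => hasSum_binomial_shift (hsummable s hs) (fun m => (hinner m).hasSum)
      (hasSum_laguerre_mul_pow ha x
        ((abs_add_le s r).trans_lt (by rw [abs_of_nonneg hr0]; linarith)))
  exact (hinner m).hasSum_iff.2 (congrFun (eq_of_eventually_hasSum_mul_pow hshift
    (hnear.mono fun s hs => hasSum_laguerre_div_one_sub_mul_pow ha x hs)) m)

theorem hasSum_laguerre_div_Gamma (x w : ℝ) :
    HasSum (fun m : ℕ => w ^ m * laguerre m a x / Real.Gamma (m + a + 1))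
      (Real.exp w * besselSeries a (-(x * w))) := by
  have hbessel := hasSum_besselSeries ha (-(x * w))
  have hexp := hasSum_pow_div_factorial w
  have hprod := hasSum_sum_antidiagonal
    (hbessel.mul hexp (summable_mul_of_summable_norm hbessel.summable.norm hexp.summable.norm))
  rw [mul_comm (besselSeries _ _)] at hprod
  refine hprod.congr_fun fun m => ?_
  rw [laguerre_eq_sum_laguerreCoeff, Finset.mul_sum, Finset.sum_div]
  refine Finset.sum_congr rfl fun p hp => ?_
  have hm := (Gamma_natCast_add_pos ha m).ne'
  have hp1 := (Gamma_natCast_add_pos ha p.1).ne'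
  rw [← mem_antidiagonal.1 hp, Nat.cast_add] at hm ⊢
  rw [laguerreCoeff, show -(x * w) = -x * w by ring, mul_pow, pow_add]
  field_simp

/-! ### The Hille–Hardy formula -/

theorem factorial_div_Gamma_mul_laguerre (n : ℕ) (y : ℝ) :
    n.factorial / Real.Gamma (n + a + 1) * laguerre n a y = ∑ p ∈ antidiagonal n,
      ((p.2 + p.1).choose p.1 : ℝ) * ((-y) ^ p.1 / Real.Gamma (p.1 + a + 1)) := by
  rw [laguerre_eq_sum_laguerreCoeff, Finset.mul_sum]
  refine Finset.sum_congr rfl fun p hp => ?_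
  have hn := (Gamma_natCast_add_pos ha n).ne'
  have hp1 := (Gamma_natCast_add_pos ha p.1).ne'
  rw [← mem_antidiagonal.1 hp, Nat.cast_add] at hn ⊢
  rw [laguerreCoeff, add_comm p.2, Nat.cast_add_choose]
  field_simp

theorem normLaguerre_mul_normLaguerre (n : ℕ) (x y : ℝ) :
    normLaguerre n a x * normLaguerre n a y =
      n.factorial / Real.Gamma (n + a + 1) * laguerre n a x * laguerre n a y := by
  have hsqrt := Real.mul_self_sqrt (div_pos (Real.Gamma_pos_of_pos n.cast_add_one_pos)
    (Gamma_natCast_add_pos ha n)).le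
  rw [← Real.Gamma_nat_eq_factorial, ← hsqrt, normLaguerre, normLaguerre]
  ring

/-- The closed form of `∑ r^n L̂_n^a(x) L̂_n^a(y)` given by the Hille–Hardy formula. It is extended
evenly in both variables, which makes it symmetric, nonnegative and measurable on all of `ℝ × ℝ`. -/
noncomputable def mehlerKernel (a r x y : ℝ) : ℝ :=
  (1 - r) ^ (-a - 1) * Real.exp (-(r * (|x| + |y|) / (1 - r))) *
    besselSeries a (r * (|x| * |y|) / (1 - r) ^ 2)

omit ha in
theorem mehlerKernel_eq_exp_mul_exp_mul_besselSeries {r x y : ℝ} (hx : 0 ≤ x) (hy : 0 ≤ y) :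
    mehlerKernel a r x y = (1 - r) ^ (-a - 1) * Real.exp (-(r * x / (1 - r))) *
      (Real.exp (-(r * y / (1 - r))) * besselSeries a (-(x / (1 - r) * -(r * y / (1 - r))))) := by
  rw [mehlerKernel, abs_of_nonneg hx, abs_of_nonneg hy,
    show -(r * (x + y) / (1 - r)) = -(r * x / (1 - r)) + -(r * y / (1 - r)) by ring, Real.exp_add,
    show -(x / (1 - r) * -(r * y / (1 - r))) = r * (x * y) / (1 - r) ^ 2 by field_simp]
  ring

theorem summable_choose_mul_laguerre_mul_pow_div_Gamma (x y : ℝ) {r : ℝ} (hr0 : 0 ≤ r)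
    (hr : r < 1) : Summable fun p : ℕ × ℕ =>
      ((p.2 + p.1).choose p.1 : ℝ) * r ^ p.2 * laguerre (p.2 + p.1) a x *
        (r ^ p.1 * ((-y) ^ p.1 / Real.Gamma (p.1 + a + 1))) := by
  obtain ⟨δ, hδ, hδr⟩ : ∃ δ, 0 < δ ∧ r * δ + r < 1 := ⟨(1 - r) / 2, by linarith, by nlinarith⟩
  obtain ⟨C, -, hC⟩ := exists_pow_div_Gamma_le ha (D := |y| / δ) (by positivity)
  have hmajorant := (summable_binomial_shift (c := fun n => laguerre n a x) (r := r) (s := r * δ)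
    (summable_abs_laguerre_mul_pow ha x (by positivity)
      (by rwa [abs_of_nonneg hr0, abs_of_nonneg (by positivity)]))).abs.mul_left C
  refine .of_norm_bounded hmajorant fun p => ?_
  have hbound : |y| ^ p.1 / Real.Gamma (p.1 + a + 1) ≤ C * δ ^ p.1 := by
    rw [← div_le_iff₀ (by positivity), div_right_comm, ← div_pow]
    exact hC p.1
  rw [Real.norm_eq_abs]
  simp only [abs_mul, abs_div, abs_pow, abs_neg, abs_of_nonneg hr0, abs_of_pos hδ,
    abs_of_pos (Gamma_natCast_add_pos ha p.1), Nat.abs_cast, mul_pow]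
  calc _ ≤ ((p.2 + p.1).choose p.1 : ℝ) * r ^ p.2 * |laguerre (p.2 + p.1) a x| *
        (r ^ p.1 * (C * δ ^ p.1)) := by gcongr
    _ = _ := by ring

theorem hasSum_pow_mul_normLaguerre_mul_normLaguerre {r : ℝ} (hr0 : 0 ≤ r) (hr : r < 1)
    {x y : ℝ} (hx : 0 ≤ x) (hy : 0 ≤ y) :
    HasSum (fun n => r ^ n * (normLaguerre n a x * normLaguerre n a y))
      (mehlerKernel a r x y) := by
  have hsum := (summable_choose_mul_laguerre_mul_pow_div_Gamma ha x y hr0 hr).hasSum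
  have hval := (hasSum_laguerre_div_Gamma ha (x / (1 - r)) (-(r * y / (1 - r)))).mul_left
    ((1 - r) ^ (-a - 1) * Real.exp (-(r * x / (1 - r))))
  rw [← mehlerKernel_eq_exp_mul_exp_mul_besselSeries hx hy] at hval
  have hfiber := hsum.prod_fiberwise fun m =>
    (hasSum_choose_mul_laguerre ha x hr0 hr m).mul_right
      (r ^ m * ((-y) ^ m / Real.Gamma (m + a + 1)))
  rw [hfiber.unique (hval.congr_fun fun m => by
    rw [show -(r * y / (1 - r)) = r * -y / (1 - r) by ring, div_pow, mul_pow]; ring)] at hsum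
  refine (hasSum_sum_antidiagonal hsum).congr_fun fun n => ?_
  rw [normLaguerre_mul_normLaguerre ha, mul_right_comm, factorial_div_Gamma_mul_laguerre ha,
    Finset.sum_mul, Finset.mul_sum]
  refine Finset.sum_congr rfl fun p hp => ?_
  rw [← mem_antidiagonal.1 hp, add_comm p.1, pow_add]
  ring

end

/-! ### Integration against one-dimensional Laguerre measures -/

/-- `f` is integrable with integral `S`. Like `HasSum`, this keeps convergence and value together,
which the junk value of `∫` does not. -/
def HasBochnerIntegral {X E : Type*} [MeasurableSpace X] [NormedAddCommGroup E] [NormedSpace ℝ E]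
    (f : X → E) (μ : Measure X) (S : E) : Prop :=
  Integrable f μ ∧ ∫ x, f x ∂μ = S

namespace HasBochnerIntegral

variable {X ι E : Type*} [MeasurableSpace X] {μ : Measure X}
  [NormedAddCommGroup E] [NormedSpace ℝ E]

theorem congr_ae {f g : X → E} {S : E} (hf : HasBochnerIntegral f μ S) (h : f =ᵐ[μ] g) :
    HasBochnerIntegral g μ S :=
  ⟨hf.1.congr h, (integral_congr_ae h).symm.trans hf.2⟩

theorem const_mul {f : X → ℝ} {S : ℝ} (hf : HasBochnerIntegral f μ S) (c : ℝ) :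
    HasBochnerIntegral (fun x => c * f x) μ (c * S) :=
  ⟨hf.1.const_mul c, by rw [integral_const_mul, hf.2]⟩

theorem add {f g : X → E} {S T : E} (hf : HasBochnerIntegral f μ S)
    (hg : HasBochnerIntegral g μ T) : HasBochnerIntegral (fun x => f x + g x) μ (S + T) :=
  ⟨hf.1.add hg.1, by rw [integral_add hf.1 hg.1, hf.2, hg.2]⟩

theorem le_of_ae_le {f g : X → ℝ} {S T : ℝ} (hf : HasBochnerIntegral f μ S)
    (hg : HasBochnerIntegral g μ T) (h : f ≤ᵐ[μ] g) : S ≤ T :=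
  hf.2 ▸ hg.2 ▸ integral_mono_ae hf.1 hg.1 h

theorem indicator_restrict {f : X → E} {S : E} {s t : Set X}
    (hf : HasBochnerIntegral f (μ.restrict s) S) (hs : MeasurableSet s) (hst : s ⊆ t) :
    HasBochnerIntegral (s.indicator f) (μ.restrict t) S := by
  rw [HasBochnerIntegral, integrable_indicator_iff hs, integral_indicator hs, IntegrableOn,
    Measure.restrict_restrict_of_subset hst]
  exact hf

theorem finset_sum {f : ι → X → E} {S : ι → E} (s : Finset ι)
    (hf : ∀ i ∈ s, HasBochnerIntegral (f i) μ (S i)) :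
    HasBochnerIntegral (fun x => ∑ i ∈ s, f i x) μ (∑ i ∈ s, S i) :=
  ⟨integrable_finsetSum _ fun i hi => (hf i hi).1, by
    rw [integral_finsetSum _ fun i hi => (hf i hi).1]
    exact Finset.sum_congr rfl fun i hi => (hf i hi).2⟩

theorem of_hasSum [Countable ι] {F : ι → X → E} {f : X → E} {c : ι → E} {S : E}
    (hF : ∀ i, HasBochnerIntegral (F i) μ (c i)) (hnorm : Summable fun i => ∫ x, ‖F i x‖ ∂μ)
    (hc : HasSum c S) (hf : ∀ᵐ x ∂μ, HasSum (fun i => F i x) (f x)) :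
    HasBochnerIntegral f μ S := by
  have htsum : f =ᵐ[μ] fun x => ∑' i, F i x := hf.mono fun x hx => hx.tsum_eq.symm
  have hfinite : ∫⁻ x, ∑' i, ‖F i x‖ₑ ∂μ ≠ ∞ := by
    rw [lintegral_tsum fun i => (hF i).1.1.enorm,
      tsum_congr fun i => (ofReal_integral_norm_eq_lintegral_enorm (hF i).1).symm]
    exact hnorm.tsum_ofReal_ne_top
  refine ⟨⟨aestronglyMeasurable_of_tendsto_ae atTop
    (fun s => s.aestronglyMeasurable_fun_sum fun i _ => (hF i).1.1) hf, ?_⟩, ?_⟩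
  · refine (lintegral_mono_ae (htsum.mono fun x hx => ?_)).trans_lt hfinite.lt_top
    rw [hx]
    exact enorm_tsum_le_tsum_enorm
  · rw [integral_congr_ae htsum]
    exact (hasSum_integral_of_summable_integral_norm (fun i => (hF i).1) hnorm).unique
      (hc.congr_fun fun i => (hF i).2)

theorem of_hasSum_of_nonneg [Countable ι] {F : ι → X → ℝ} {f : X → ℝ} {c : ι → ℝ} {S : ℝ}
    (hF : ∀ i, HasBochnerIntegral (F i) μ (c i)) (hnonneg : ∀ i, ∀ᵐ x ∂μ, 0 ≤ F i x)
    (hc : HasSum c S) (hf : ∀ᵐ x ∂μ, HasSum (fun i => F i x) (f x)) :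
    HasBochnerIntegral f μ S :=
  of_hasSum hF (hc.summable.congr fun i => by
    rw [← (hF i).2]
    exact integral_congr_ae ((hnonneg i).mono fun x hx => (Real.norm_of_nonneg hx).symm)) hc hf

end HasBochnerIntegral

/-- The measure `x^a e^{-x} dx` on `(0, ∞)`. -/
noncomputable def laguerreMeasureReal (a : ℝ) : Measure ℝ :=
  (volume.restrict (Set.Ioi 0)).withDensity fun x => ENNReal.ofReal (x ^ a * Real.exp (-x))

theorem ae_laguerreMeasureReal_pos (a : ℝ) : ∀ᵐ y ∂laguerreMeasureReal a, 0 < y :=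
  (withDensity_absolutelyContinuous _ _).ae_le (ae_restrict_mem measurableSet_Ioi)

instance (a : ℝ) : SigmaFinite (laguerreMeasureReal a) := by
  unfold laguerreMeasureReal
  infer_instance

theorem hasBochnerIntegral_laguerreMeasureReal_iff {a S : ℝ} {f : ℝ → ℝ} :
    HasBochnerIntegral f (laguerreMeasureReal a) S ↔
      HasBochnerIntegral (fun y => y ^ a * Real.exp (-y) * f y)
        (volume.restrict (Set.Ioi 0)) S := by
  have hdensity : (fun y => (ENNReal.ofReal (y ^ a * Real.exp (-y))).toReal • f y)
      =ᵐ[volume.restrict (Set.Ioi 0)] fun y => y ^ a * Real.exp (-y) * f y := by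
    filter_upwards [ae_restrict_mem measurableSet_Ioi] with y (hy : 0 < y)
    rw [ENNReal.toReal_ofReal (by positivity), smul_eq_mul]
  rw [HasBochnerIntegral, HasBochnerIntegral, laguerreMeasureReal,
    integrable_withDensity_iff_integrable_smul' (by fun_prop) (by simp),
    integral_withDensity_eq_integral_toReal_smul (by fun_prop) (by simp),
    integrable_congr hdensity, integral_congr_ae hdensity]

theorem hasBochnerIntegral_rpow_mul_iff {a σ S : ℝ} {f : ℝ → ℝ} :
    HasBochnerIntegral (fun y => y ^ σ * f y) (laguerreMeasureReal a) S ↔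
      HasBochnerIntegral f (laguerreMeasureReal (a + σ)) S := by
  have hweight : (fun y => y ^ a * Real.exp (-y) * (y ^ σ * f y))
      =ᵐ[volume.restrict (Set.Ioi 0)] fun y => y ^ (a + σ) * Real.exp (-y) * f y := by
    filter_upwards [ae_restrict_mem measurableSet_Ioi] with y (hy : 0 < y)
    rw [Real.rpow_add hy]
    ring
  rw [hasBochnerIntegral_laguerreMeasureReal_iff, hasBochnerIntegral_laguerreMeasureReal_iff]
  exact ⟨fun h => h.congr_ae hweight, fun h => h.congr_ae hweight.symm⟩

theorem hasBochnerIntegral_rpow_mul_exp_neg_mul {c z : ℝ} (hc : -1 < c) (hz : 0 < z) :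
    HasBochnerIntegral (fun v => v ^ c * Real.exp (-(z * v))) (volume.restrict (Set.Ioi 0))
      (Real.Gamma (c + 1) / z ^ (c + 1)) := by
  constructor
  · simpa only [Real.rpow_one, neg_mul, IntegrableOn] using
      integrableOn_rpow_mul_exp_neg_mul_rpow (p := 1) hc one_pos hz
  · have hvalue := Real.integral_rpow_mul_exp_neg_mul_Ioi (a := c + 1) (by linarith) hz
    rwa [add_sub_cancel_right, Real.div_rpow zero_le_one hz.le, Real.one_rpow,
      one_div_mul_eq_div] at hvalue

theorem hasBochnerIntegral_exp_neg_mul {a κ : ℝ} (ha : -1 < a) (hκ : -1 < κ) :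
    HasBochnerIntegral (fun y => Real.exp (-(κ * y))) (laguerreMeasureReal a)
      (Real.Gamma (a + 1) / (1 + κ) ^ (a + 1)) := by
  rw [hasBochnerIntegral_laguerreMeasureReal_iff]
  refine (hasBochnerIntegral_rpow_mul_exp_neg_mul ha (z := 1 + κ) (by linarith)).congr_ae
    (ae_of_all _ fun y => ?_)
  simp only [mul_assoc, ← Real.exp_add]
  ring_nf

theorem hasBochnerIntegral_pow_mul_exp_neg_mul {a κ : ℝ} (ha : -1 < a) (hκ : -1 < κ) (m : ℕ) :
    HasBochnerIntegral (fun y => y ^ m * Real.exp (-(κ * y))) (laguerreMeasureReal a)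
      (Real.Gamma (m + a + 1) / (1 + κ) ^ (m + a + 1)) := by
  have ham : -1 < a + m := by linarith [m.cast_nonneg (α := ℝ)]
  simpa only [Real.rpow_natCast, add_comm a] using
    hasBochnerIntegral_rpow_mul_iff.2 (hasBochnerIntegral_exp_neg_mul ham hκ)

theorem hasBochnerIntegral_pow {a : ℝ} (ha : -1 < a) (m : ℕ) :
    HasBochnerIntegral (fun y => y ^ m) (laguerreMeasureReal a) (Real.Gamma (m + a + 1)) := by
  simpa using hasBochnerIntegral_pow_mul_exp_neg_mul ha (κ := 0) (by norm_num) m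

/-! ### Orthonormality of Laguerre polynomials -/

section

variable {a : ℝ} (ha : -1 < a)
include ha

/-- Against a power `y^k` the Laguerre polynomial `L_n^a` acts as an `n`-th finite difference of a
polynomial of degree `k`; this is the source of orthogonality. -/
theorem hasBochnerIntegral_laguerre_mul_pow (n k : ℕ) :
    HasBochnerIntegral (fun y => laguerre n a y * y ^ k) (laguerreMeasureReal a)
      ((-1) ^ n * (Real.Gamma (n + a + 1) / n.factorial) *
        ((fwdDiff 1)^[n] (ascPochhammer ℝ k).eval) (a + 1)) := by
  have hterm := HasBochnerIntegral.finset_sum (antidiagonal n) fun p _ =>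
    (hasBochnerIntegral_pow ha (p.1 + k)).const_mul (laguerreCoeff a p.1 p.2 * (-1) ^ p.1)
  convert! hterm using 1
  · ext y
    rw [laguerre_eq_sum_laguerreCoeff, Finset.sum_mul]
    refine Finset.sum_congr rfl fun p _ => ?_
    rw [neg_pow, pow_add]
    ring
  · rw [fwdDiff_iter_eq_sum_shift, Finset.mul_sum,
      ← Finset.Nat.sum_antidiagonal_eq_sum_range_succ fun i j => (-1) ^ n *
        (Real.Gamma (n + a + 1) / n.factorial) *
        (((-1) ^ j * (n.choose i : ℤ)) • (ascPochhammer ℝ k).eval (a + 1 + i • (1 : ℝ)))]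
    refine Finset.sum_congr rfl fun p hp => ?_
    have := Gamma_natCast_add_pos ha p.1
    have hpos : 0 < p.1 + a + 1 := by linarith [p.1.cast_nonneg (α := ℝ)]
    have hsign : ((-1) ^ p.2 * (-1) ^ p.2 : ℝ) = 1 := by rw [← mul_pow]; simp
    rw [← mem_antidiagonal.1 hp, laguerreCoeff, Nat.cast_add, Nat.cast_add,
      show (p.1 : ℝ) + k + a + 1 = p.1 + a + 1 + k by ring, Gamma_add_natCast hpos,
      zsmul_eq_mul, nsmul_eq_mul, mul_one, show a + 1 + (p.1 : ℝ) = p.1 + a + 1 by ring, pow_add]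
    push_cast
    rw [Nat.cast_add_choose]
    field_simp
    linear_combination Real.Gamma (p.1 + p.2 + a + 1) *
      (ascPochhammer ℝ k).eval (p.1 + a + 1) * hsign

theorem hasBochnerIntegral_laguerre_mul_pow_of_le {n k : ℕ} (hkn : k ≤ n) :
    HasBochnerIntegral (fun y => laguerre n a y * y ^ k) (laguerreMeasureReal a)
      (if k = n then (-1) ^ n * Real.Gamma (n + a + 1) else 0) := by
  convert! hasBochnerIntegral_laguerre_mul_pow ha n k using 1
  split_ifs with h
  · have hdiff := Polynomial.fwdDiff_iter_degree_eq_factorial (ascPochhammer ℝ n)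
    rw [ascPochhammer_natDegree, (monic_ascPochhammer ℝ n).leadingCoeff, one_smul] at hdiff
    rw [h, hdiff, Pi.natCast_apply]
    field_simp
  · rw [Polynomial.fwdDiff_iter_eq_zero_of_degree_lt
      (by rw [ascPochhammer_natDegree]; exact lt_of_le_of_ne hkn h), Pi.zero_apply, mul_zero]

theorem hasBochnerIntegral_laguerre_mul_laguerre (n m : ℕ) :
    HasBochnerIntegral (fun y => laguerre n a y * laguerre m a y) (laguerreMeasureReal a)
      (if n = m then Real.Gamma (n + a + 1) / n.factorial else 0) := by
  wlog hmn : m ≤ n generalizing n m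
  · convert! this m n (by omega) using 1
    · simp only [mul_comm]
    · rw [if_neg (by omega), if_neg (by omega)]
  have hterm := HasBochnerIntegral.finset_sum (antidiagonal m) fun p hp =>
    (hasBochnerIntegral_laguerre_mul_pow_of_le ha
      (show p.1 ≤ n by have := mem_antidiagonal.1 hp; omega)).const_mul
        (laguerreCoeff a p.1 p.2 * (-1) ^ p.1)
  convert! hterm using 1
  · ext y
    rw [laguerre_eq_sum_laguerreCoeff m, Finset.mul_sum]
    refine Finset.sum_congr rfl fun p _ => ?_
    rw [neg_pow]
    ring
  · rw [Finset.sum_eq_single (m, 0)]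
    · have hΓ := (Gamma_natCast_add_pos ha m).ne'
      have hsign : ((-1) ^ m * (-1) ^ m : ℝ) = 1 := by rw [← mul_pow]; simp
      simp only [eq_comm (a := n)]
      split_ifs with h
      · subst h
        simp only [laguerreCoeff, Nat.cast_zero, add_zero, Nat.factorial_zero, Nat.cast_one]
        field_simp
        linear_combination -hsign
      · rw [mul_zero]
    · intro p hp hne
      have hsum := mem_antidiagonal.1 hp
      rw [if_neg, mul_zero]
      intro h
      exact hne (Prod.ext (by simp only; omega) (by simp only; omega))
    · simp

theorem hasBochnerIntegral_normLaguerre_mul_normLaguerre (n m : ℕ) :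
    HasBochnerIntegral (fun y => normLaguerre n a y * normLaguerre m a y) (laguerreMeasureReal a)
      (if n = m then 1 else 0) := by
  convert! (hasBochnerIntegral_laguerre_mul_laguerre ha n m).const_mul
    (√(Real.Gamma (n + 1) / Real.Gamma (n + a + 1)) *
      √(Real.Gamma (m + 1) / Real.Gamma (m + a + 1))) using 1
  · ext y
    rw [normLaguerre, normLaguerre]
    ring
  · split_ifs with h
    · have hn := Gamma_natCast_add_pos ha n
      rw [← h, Real.mul_self_sqrt (div_pos (Real.Gamma_pos_of_pos n.cast_add_one_pos) hn).le,
        Real.Gamma_nat_eq_factorial]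
      field_simp
    · rw [mul_zero]

theorem integral_norm_normLaguerre_mul_normLaguerre_le (n m : ℕ) :
    ∫ y, ‖normLaguerre n a y * normLaguerre m a y‖ ∂laguerreMeasureReal a ≤ 1 := by
  have horth := hasBochnerIntegral_normLaguerre_mul_normLaguerre ha
  have hmajorant := ((horth n n).add (horth m m)).const_mul (1 / 2)
  rw [if_pos rfl, if_pos rfl] at hmajorant
  calc _ ≤ ∫ y, 1 / 2 * (normLaguerre n a y * normLaguerre n a y +
          normLaguerre m a y * normLaguerre m a y) ∂laguerreMeasureReal a := by
        refine integral_mono (horth n m).1.norm hmajorant.1 fun y => ?_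
        simp only [Real.norm_eq_abs]
        rw [abs_le]
        constructor <;> nlinarith [sq_nonneg (normLaguerre n a y - normLaguerre m a y),
          sq_nonneg (normLaguerre n a y + normLaguerre m a y)]
    _ = 1 := by rw [hmajorant.2]; norm_num

end

/-! ### The Mehler kernel -/

theorem mehlerKernel_abs_left (a r x y : ℝ) : mehlerKernel a r |x| y = mehlerKernel a r x y := by
  simp [mehlerKernel]

theorem mehlerKernel_abs_right (a r x y : ℝ) :
    mehlerKernel a r x |y| = mehlerKernel a r x y := by
  simp [mehlerKernel]

theorem mehlerKernel_symm (a r x y : ℝ) : mehlerKernel a r x y = mehlerKernel a r y x := by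
  simp only [mehlerKernel, mul_comm |x| |y|, add_comm |x| |y|]

theorem measurable_mehlerKernel (a r : ℝ) :
    Measurable fun p : ℝ × ℝ => mehlerKernel a r p.1 p.2 := by
  have : Measurable (besselSeries a) := by
    unfold besselSeries
    exact Measurable.tsum fun m => by fun_prop
  unfold mehlerKernel
  fun_prop

theorem hasSum_diagonal_iff {ι E : Type*} [DecidableEq ι] [AddCommMonoid E] [TopologicalSpace E]
    {f : ι × ι → E} {S : E} :
    HasSum (fun p : ι × ι => if p.1 = p.2 then f p else 0) S ↔ HasSum (fun i => f (i, i)) S := by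
  have hinj : Function.Injective fun i : ι => (i, i) := fun i j h => congrArg Prod.fst h
  rw [← hinj.hasSum_iff]
  · simp [Function.comp_def]
  · rintro ⟨i, j⟩ h
    exact if_neg fun hij : i = j => h ⟨i, by rw [hij]⟩

section

variable {a : ℝ} (ha : -1 < a)
include ha

theorem besselSeries_nonneg {w : ℝ} (hw : 0 ≤ w) : 0 ≤ besselSeries a w :=
  tsum_nonneg fun m => by
    have := Gamma_natCast_add_pos ha m
    positivity

theorem exists_besselSeries_mul_le {A : ℝ} (hA : 0 ≤ A) :
    ∃ C, 0 < C ∧ ∀ w, 0 ≤ w → besselSeries a (A * w) ≤ C * Real.exp w := by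
  obtain ⟨C, hC, hpow⟩ := exists_pow_div_Gamma_le ha hA
  refine ⟨C, hC, fun w hw => hasSum_le (fun m => ?_) (hasSum_besselSeries ha _)
    ((hasSum_pow_div_factorial w).mul_left C)⟩
  have hΓ := Gamma_natCast_add_pos ha m
  calc (A * w) ^ m / (m.factorial * Real.Gamma (m + a + 1))
      = A ^ m / Real.Gamma (m + a + 1) * (w ^ m / m.factorial) := by
        rw [mul_pow]
        field_simp
    _ ≤ C * (w ^ m / m.factorial) := by gcongr; exact hpow m

variable {r : ℝ}

theorem mehlerKernel_nonneg (hr0 : 0 ≤ r) (hr : r < 1) (x y : ℝ) : 0 ≤ mehlerKernel a r x y := by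
  have h1r : 0 < 1 - r := by linarith
  have := besselSeries_nonneg (w := r * (|x| * |y|) / (1 - r) ^ 2) ha (by positivity)
  have := Real.rpow_nonneg h1r.le (-a - 1)
  unfold mehlerKernel
  positivity

theorem exists_mehlerKernel_le_exp_neg (hr0 : 0 < r) (hr : r < 1) (x : ℝ) :
    ∃ C δ, 0 < C ∧ 0 < δ ∧ ∀ y, mehlerKernel a r x y ≤ C * Real.exp (-(δ * |y|)) := by
  have h1r : 0 < 1 - r := by linarith
  obtain ⟨C, hC, hbessel⟩ := exists_besselSeries_mul_le ha (A := 2 * |x| / (1 - r)) (by positivity)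
  have := Real.rpow_pos_of_pos h1r (-a - 1)
  refine ⟨(1 - r) ^ (-a - 1) * C, r / (2 * (1 - r)), by positivity, by positivity, fun y => ?_⟩
  set w := r / (2 * (1 - r)) * |y| with hw
  have hw0 : 0 ≤ w := by positivity
  have hexp : Real.exp (-(r * (|x| + |y|) / (1 - r))) ≤ Real.exp (-w) * Real.exp (-w) := by
    have hsplit : r * (|x| + |y|) / (1 - r) = r * |x| / (1 - r) + (w + w) := by
      rw [hw]
      field_simp
      ring
    have : 0 ≤ r * |x| / (1 - r) := by positivity
    rw [← Real.exp_add, Real.exp_le_exp]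
    linarith
  rw [mehlerKernel,
    show r * (|x| * |y|) / (1 - r) ^ 2 = 2 * |x| / (1 - r) * w by rw [hw]; field_simp]
  calc _ ≤ (1 - r) ^ (-a - 1) * (Real.exp (-w) * Real.exp (-w)) * (C * Real.exp w) := by
        gcongr
        · exact besselSeries_nonneg ha (by positivity)
        · exact hbessel w hw0
    _ = (1 - r) ^ (-a - 1) * C * Real.exp (-w) * (Real.exp (-w) * Real.exp w) := by ring
    _ = (1 - r) ^ (-a - 1) * C * Real.exp (-w) := by
        rw [← Real.exp_add, neg_add_cancel, Real.exp_zero, mul_one]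

theorem exists_mehlerKernel_le (hr0 : 0 < r) (hr : r < 1) (x : ℝ) :
    ∃ M, ∀ y, mehlerKernel a r x y ≤ M := by
  obtain ⟨C, δ, hC, hδ, h⟩ := exists_mehlerKernel_le_exp_neg ha hr0 hr x
  refine ⟨C, fun y => (h y).trans (mul_le_of_le_one_right hC.le (Real.exp_le_one_iff.2 ?_))⟩
  exact neg_nonpos.2 (by positivity)

theorem exists_sqrt_mul_mehlerKernel_le (hr0 : 0 < r) (hr : r < 1) (x : ℝ) :
    ∃ M, ∀ y, √|y| * mehlerKernel a r x y ≤ M := by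
  obtain ⟨C, δ, hC, hδ, h⟩ := exists_mehlerKernel_le_exp_neg ha hr0 hr x
  refine ⟨C * (1 + 1 / δ), fun y => ?_⟩
  have hsqrt : √|y| ≤ 1 + |y| := Real.sqrt_le_iff.2 ⟨by positivity, by nlinarith [abs_nonneg y]⟩
  have hexp : (1 + |y|) * Real.exp (-(δ * |y|)) ≤ 1 + 1 / δ := by
    rw [Real.exp_neg, ← div_eq_mul_inv, div_le_iff₀ (Real.exp_pos _)]
    calc 1 + |y| ≤ (1 + 1 / δ) * (1 + δ * |y|) := by
          have : (1 + 1 / δ) * (1 + δ * |y|) = 1 + |y| + (1 / δ + δ * |y|) := by field_simp; ring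
          have : 0 ≤ 1 / δ + δ * |y| := by positivity
          linarith
      _ ≤ _ := by gcongr; linarith [Real.add_one_le_exp (δ * |y|)]
  calc √|y| * mehlerKernel a r x y ≤ (1 + |y|) * (C * Real.exp (-(δ * |y|))) := by
        gcongr
        · exact mehlerKernel_nonneg ha hr0.le hr x y
        · exact h y
    _ = C * ((1 + |y|) * Real.exp (-(δ * |y|))) := by ring
    _ ≤ _ := by gcongr

/-- The `ρ`-integral of the Mehler kernel of order `a`, reduced to a series by expanding the Bessel
function; `ρ = a` gives the total mass and `ρ = a - 1/2` the mass of the modified kernel. -/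
theorem hasBochnerIntegral_mehlerKernel {ρ x S : ℝ} (hρ : -1 < ρ) (hr0 : 0 ≤ r) (hr : r < 1)
    (hS : HasSum (fun m : ℕ => (r * |x| / (1 - r)) ^ m / m.factorial *
      (Real.Gamma (m + ρ + 1) / Real.Gamma (m + a + 1))) S) :
    HasBochnerIntegral (mehlerKernel a r x) (laguerreMeasureReal ρ)
      (Real.exp (-(r * |x| / (1 - r))) * (1 - r) ^ (ρ - a) * S) := by
  have h1r : 0 < 1 - r := by linarith
  have hκ : 0 ≤ r / (1 - r) := by positivity
  set c : ℕ → ℝ := fun m => (1 - r) ^ (-a - 1) * Real.exp (-(r * |x| / (1 - r))) *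
    ((r * |x| / (1 - r) ^ 2) ^ m / (m.factorial * Real.Gamma (m + a + 1))) with hc
  refine HasBochnerIntegral.of_hasSum_of_nonneg (fun m =>
    (hasBochnerIntegral_pow_mul_exp_neg_mul hρ (κ := r / (1 - r)) (by linarith) m).const_mul (c m))
    (fun m => ?_) ((hS.mul_left _).congr_fun fun m => ?_) ?_
  · filter_upwards [ae_laguerreMeasureReal_pos ρ] with y hy
    have := Gamma_natCast_add_pos ha m
    have := Real.rpow_nonneg h1r.le (-a - 1)
    positivity
  · have hΓ := (Gamma_natCast_add_pos ha m).ne'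
    have hpow := (Real.rpow_pos_of_pos h1r (-a - 1)).ne'
    rw [show 1 + r / (1 - r) = (1 - r)⁻¹ by field_simp; ring, Real.inv_rpow h1r.le,
      show (m : ℝ) + ρ + 1 = (ρ - a) + (m - (-a - 1)) by ring, Real.rpow_add h1r,
      Real.rpow_sub h1r m, Real.rpow_natCast, hc]
    simp only [div_pow, mul_pow, pow_right_comm _ 2]
    field_simp
  · filter_upwards [ae_laguerreMeasureReal_pos ρ] with y hy
    refine ((hasSum_besselSeries ha (r * (|x| * |y|) / (1 - r) ^ 2)).mul_left
      ((1 - r) ^ (-a - 1) * Real.exp (-(r * (|x| + |y|) / (1 - r))))).congr_fun fun m => ?_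
    rw [abs_of_pos hy, show -(r * (|x| + y) / (1 - r)) =
      -(r * |x| / (1 - r)) + -(r / (1 - r) * y) by ring, Real.exp_add,
      show r * (|x| * y) / (1 - r) ^ 2 = r * |x| / (1 - r) ^ 2 * y by ring, mul_pow, hc]
    ring

theorem hasBochnerIntegral_mehlerKernel_self (hr0 : 0 ≤ r) (hr : r < 1) (x : ℝ) :
    HasBochnerIntegral (mehlerKernel a r x) (laguerreMeasureReal a) 1 := by
  have hseries := (hasSum_pow_div_factorial (r * |x| / (1 - r))).congr_fun
    (g := fun m : ℕ => (r * |x| / (1 - r)) ^ m / m.factorial *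
      (Real.Gamma (m + a + 1) / Real.Gamma (m + a + 1))) fun m => by
      rw [div_self (Gamma_natCast_add_pos ha m).ne', mul_one]
  simpa [← Real.exp_add] using hasBochnerIntegral_mehlerKernel ha ha hr0 hr hseries

theorem summable_pow_mul_abs_normLaguerre (hr0 : 0 ≤ r) (hr : r < 1) {x : ℝ} (hx : 0 ≤ x) :
    Summable fun n => |r ^ n * normLaguerre n a x| := by
  have hsquare := hasSum_pow_mul_normLaguerre_mul_normLaguerre ha hr0 hr hx hx
  refine .of_nonneg_of_le (fun n => abs_nonneg _) (fun n => ?_)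
    (hsquare.summable.add (summable_geometric_of_lt_one hr0 hr))
  have hle : |normLaguerre n a x| ≤ normLaguerre n a x * normLaguerre n a x + 1 :=
    abs_le.2 ⟨by nlinarith [sq_nonneg (normLaguerre n a x + 1)],
      by nlinarith [sq_nonneg (normLaguerre n a x - 1)]⟩
  rw [abs_mul, abs_of_nonneg (pow_nonneg hr0 n)]
  calc _ ≤ r ^ n * (normLaguerre n a x * normLaguerre n a x + 1) := by gcongr
    _ = _ := by ring

theorem hasBochnerIntegral_mehlerKernel_mul_mehlerKernel {s : ℝ} (hr0 : 0 ≤ r) (hr : r < 1)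
    (hs0 : 0 ≤ s) (hs : s < 1) (x z : ℝ) :
    HasBochnerIntegral (fun y => mehlerKernel a r x y * mehlerKernel a s y z)
      (laguerreMeasureReal a) (mehlerKernel a (r * s) x z) := by
  wlog h : 0 ≤ x ∧ 0 ≤ z generalizing x z
  · simpa only [mehlerKernel_abs_left, mehlerKernel_abs_right] using
      this |x| |z| ⟨abs_nonneg x, abs_nonneg z⟩
  obtain ⟨hx, hz⟩ := h
  have hmehler {r x y : ℝ} := hasSum_pow_mul_normLaguerre_mul_normLaguerre ha (r := r) (x := x)
    (y := y)
  set c : ℕ × ℕ → ℝ := fun p =>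
    r ^ p.1 * normLaguerre p.1 a x * (s ^ p.2 * normLaguerre p.2 a z) with hc
  have hsummable : Summable fun p => ‖c p‖ :=
    ((summable_pow_mul_abs_normLaguerre ha hr0 hr hx).mul_of_nonneg
      (summable_pow_mul_abs_normLaguerre ha hs0 hs hz) (fun _ => abs_nonneg _)
      fun _ => abs_nonneg _).congr fun p => (abs_mul _ _).symm
  refine .of_hasSum (fun p : ℕ × ℕ =>
    (hasBochnerIntegral_normLaguerre_mul_normLaguerre ha p.1 p.2).const_mul (c p)) ?_ ?_ ?_
  · refine .of_nonneg_of_le (fun p => integral_nonneg fun _ => norm_nonneg _) (fun p => ?_)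
      hsummable
    simp only [norm_mul (c p)]
    rw [integral_const_mul]
    exact mul_le_of_le_one_right (norm_nonneg _)
      (integral_norm_normLaguerre_mul_normLaguerre_le ha p.1 p.2)
  · simp only [mul_ite, mul_one, mul_zero]
    refine hasSum_diagonal_iff.2 ((hmehler (mul_nonneg hr0 hs0) (by nlinarith) hx hz).congr_fun
      fun n => ?_)
    rw [hc, mul_pow]
    ring
  · filter_upwards [ae_laguerreMeasureReal_pos a] with y hy
    have hxy := hmehler hr0 hr hx hy.le
    have hyz := hmehler hs0 hs hy.le hz
    refine (hxy.mul hyz (summable_mul_of_summable_norm hxy.summable.norm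
      hyz.summable.norm)).congr_fun fun p => ?_
    rw [hc]
    ring

end

/-- The kernel `r √(xy) K_r^{a+1}(x, y)` of the modified one-dimensional semigroup. -/
noncomputable def modifiedMehlerKernel (a r x y : ℝ) : ℝ :=
  r * (√|x| * √|y| * mehlerKernel (a + 1) r x y)

theorem hasBochnerIntegral_modifiedMehlerKernel_mul_modifiedMehlerKernel {a r s : ℝ} (ha : -2 < a)
    (hr0 : 0 ≤ r) (hr : r < 1) (hs0 : 0 ≤ s) (hs : s < 1) (x z : ℝ) :
    HasBochnerIntegral (fun y => modifiedMehlerKernel a r x y * modifiedMehlerKernel a s y z)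
      (laguerreMeasureReal a) (modifiedMehlerKernel a (r * s) x z) := by
  have hmul := (hasBochnerIntegral_rpow_mul_iff.2
    (hasBochnerIntegral_mehlerKernel_mul_mehlerKernel (a := a + 1) (by linarith) hr0 hr hs0 hs
      x z)).const_mul (r * s * (√|x| * √|z|))
  rw [modifiedMehlerKernel, mul_assoc (r * s) (√|x| * √|z|)] at *
  refine hmul.congr_ae ?_
  filter_upwards [ae_laguerreMeasureReal_pos a] with y hy
  have hsq : √y * √y = y := Real.mul_self_sqrt hy.le
  simp only [modifiedMehlerKernel, abs_of_pos hy, Real.rpow_one]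
  linear_combination -(r * √|x| * √|z| * s * mehlerKernel (a + 1) r x y *
    mehlerKernel (a + 1) s y z * hsq)

/-! ### The mass of the modified Mehler kernel -/

theorem hasBochnerIntegral_rpow_mul_one_sub_rpow {p q : ℝ} (hp : 0 < p) (hq : 0 < q) :
    HasBochnerIntegral (fun v => v ^ (p - 1) * (1 - v) ^ (q - 1))
      (volume.restrict (Set.Ioo 0 1)) (ProbabilityTheory.beta p q) := by
  have hbeta := ProbabilityTheory.beta_pos hp hq
  set f : ℝ → ℝ := fun v => 1 / ProbabilityTheory.beta p q * v ^ (p - 1) * (1 - v) ^ (q - 1)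
    with hf
  have hlintegral : ∫⁻ v in Set.Ioo 0 1, ENNReal.ofReal (f v) = 1 := by
    rw [← ProbabilityTheory.lintegral_betaPDF, ProbabilityTheory.lintegral_betaPDF_eq_one hp hq]
  have hnonneg : 0 ≤ᵐ[volume.restrict (Set.Ioo 0 1)] f := by
    filter_upwards [ae_restrict_mem measurableSet_Ioo] with v hv
    have := Real.rpow_nonneg hv.1.le (p - 1)
    have := Real.rpow_nonneg (sub_pos.2 hv.2).le (q - 1)
    simp only [Pi.zero_apply, hf]
    positivity
  have hmeas : AEStronglyMeasurable f (volume.restrict (Set.Ioo 0 1)) :=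
    Measurable.aestronglyMeasurable (by fun_prop)
  have hpdf : HasBochnerIntegral f (volume.restrict (Set.Ioo 0 1)) 1 :=
    ⟨(lintegral_ofReal_ne_top_iff_integrable hmeas hnonneg).1 (by simp [hlintegral]), by
      rw [integral_eq_lintegral_of_nonneg_ae hnonneg hmeas, hlintegral, ENNReal.toReal_one]⟩
  convert! hpdf.const_mul (ProbabilityTheory.beta p q) using 1
  · ext v
    simp only [hf]
    field_simp
  · rw [mul_one]

/-- The ratio `Γ(m + b + 1/2) / Γ(m + b + 1)`, which appears when a Mehler kernel of order `b` is
integrated against the Laguerre measure of order `b - 1/2`. -/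
noncomputable def halfShiftGammaRatio (b : ℝ) (m : ℕ) : ℝ :=
  Real.Gamma (m + (b - 1 / 2) + 1) / Real.Gamma (m + b + 1)

/-- The function `√z e^{-z} ∑ z^m / m! Γ(m + b + 1/2) / Γ(m + b + 1)`. At `z = r x / (1 - r)` it is,
up to the factor `√r`, the mass of the modified Mehler kernel of order `b - 1`. -/
noncomputable def modifiedMass (b z : ℝ) : ℝ :=
  √z * Real.exp (-z) * ∑' m : ℕ, z ^ m / m.factorial * halfShiftGammaRatio b m

section

variable {b z : ℝ} (hb : -1 / 2 < b)
include hb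

theorem halfShiftGammaRatio_pos (m : ℕ) : 0 < halfShiftGammaRatio b m :=
  div_pos (Gamma_natCast_add_pos (by linarith) m) (Gamma_natCast_add_pos (by linarith) m)

theorem halfShiftGammaRatio_add_one (m : ℕ) :
    halfShiftGammaRatio (b + 1) m =
      (m + b + 1 / 2) / (m + b + 1) * halfShiftGammaRatio b m := by
  have : (0 : ℝ) ≤ m := m.cast_nonneg
  have hnum : (m : ℝ) + (b - 1 / 2) + 1 ≠ 0 := by linarith
  have hden : (m : ℝ) + b + 1 ≠ 0 := by linarith
  rw [halfShiftGammaRatio, halfShiftGammaRatio,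
    show (m : ℝ) + (b + 1 - 1 / 2) + 1 = m + (b - 1 / 2) + 1 + 1 by ring,
    show (m : ℝ) + (b + 1) + 1 = m + b + 1 + 1 by ring, Real.Gamma_add_one hnum,
    Real.Gamma_add_one hden, mul_div_mul_comm]
  ring_nf

theorem halfShiftGammaRatio_add_one_le (m : ℕ) :
    halfShiftGammaRatio (b + 1) m ≤ halfShiftGammaRatio b m := by
  have : (0 : ℝ) ≤ m := m.cast_nonneg
  rw [halfShiftGammaRatio_add_one hb]
  exact mul_le_of_le_one_left (halfShiftGammaRatio_pos hb m).le
    ((div_le_one (by linarith)).2 (by linarith))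

theorem halfShiftGammaRatio_le_zero (m : ℕ) :
    halfShiftGammaRatio b m ≤ halfShiftGammaRatio b 0 := by
  induction m with
  | zero => rfl
  | succ n ih =>
    have hshift : halfShiftGammaRatio b (n + 1) = halfShiftGammaRatio (b + 1) n := by
      simp only [halfShiftGammaRatio, Nat.cast_add_one]
      ring_nf
    exact hshift.trans_le ((halfShiftGammaRatio_add_one_le hb n).trans ih)

theorem hasSum_pow_div_factorial_mul_halfShiftGammaRatio (hz : 0 ≤ z) :
    HasSum (fun m : ℕ => z ^ m / m.factorial * halfShiftGammaRatio b m)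
      (∑' m : ℕ, z ^ m / m.factorial * halfShiftGammaRatio b m) := by
  refine (Summable.of_nonneg_of_le (fun m => ?_) (fun m => ?_)
    ((hasSum_pow_div_factorial z).summable.mul_right (halfShiftGammaRatio b 0))).hasSum
  · have := halfShiftGammaRatio_pos hb m
    positivity
  · exact mul_le_mul_of_nonneg_left (halfShiftGammaRatio_le_zero hb m) (by positivity)

end

theorem hasBochnerIntegral_modifiedMehlerKernel {a r : ℝ} (ha : -3 / 2 < a) (hr0 : 0 ≤ r)
    (hr : r < 1) (x : ℝ) :
    HasBochnerIntegral (modifiedMehlerKernel a r x) (laguerreMeasureReal a)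
      (√r * modifiedMass (a + 1) (r * |x| / (1 - r))) := by
  have h1r : 0 < 1 - r := by linarith
  have hmehler := hasBochnerIntegral_mehlerKernel (a := a + 1) (ρ := a + 1 / 2) (x := x)
    (by linarith) (by linarith) hr0 hr
    ((hasSum_pow_div_factorial_mul_halfShiftGammaRatio (b := a + 1) (z := r * |x| / (1 - r))
      (by linarith) (by positivity)).congr_fun fun m => by
        rw [halfShiftGammaRatio, show a + 1 - 1 / 2 = a + 1 / 2 by ring])
  have hkernel := ((hasBochnerIntegral_rpow_mul_iff.2 hmehler).const_mul (r * √|x|)).congr_ae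
    (g := modifiedMehlerKernel a r x) (by
      filter_upwards [ae_laguerreMeasureReal_pos a] with y hy
      rw [modifiedMehlerKernel, abs_of_pos hy, ← Real.sqrt_eq_rpow]
      ring)
  convert! hkernel using 1
  rw [modifiedMass, show a + 1 / 2 - (a + 1) = -(1 / 2) by ring, Real.rpow_neg h1r.le,
    ← Real.sqrt_eq_rpow, Real.sqrt_div (by positivity), Real.sqrt_mul hr0]
  generalize (∑' m : ℕ, _ : ℝ) = S
  field_simp
  rw [Real.sq_sqrt hr0]
  ring

/-- The density of the Gamma distribution with shape `1/2` and rate `z`. The function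
`modifiedMass b z` is the expectation of `(1 - V)^{b - 1/2}` over `V < 1` for a random variable `V`
with this distribution, which makes its size readable. -/
noncomputable def gammaHalfDensity (z v : ℝ) : ℝ :=
  √z / √Real.pi * (v ^ (-(1 / 2) : ℝ) * Real.exp (-(z * v)))

theorem gammaHalfDensity_nonneg (z : ℝ) {v : ℝ} (hv : 0 ≤ v) : 0 ≤ gammaHalfDensity z v := by
  unfold gammaHalfDensity
  positivity

theorem hasBochnerIntegral_gammaHalfDensity {z : ℝ} (hz : 0 < z) :
    HasBochnerIntegral (gammaHalfDensity z) (volume.restrict (Set.Ioi 0)) 1 := by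
  have hgamma := (hasBochnerIntegral_rpow_mul_exp_neg_mul (c := -(1 / 2)) (by norm_num)
    hz).const_mul (√z / √Real.pi)
  rw [show (-(1 / 2) + 1 : ℝ) = 1 / 2 by norm_num, Real.Gamma_one_half_eq,
    ← Real.sqrt_eq_rpow] at hgamma
  convert! hgamma using 1
  field_simp

theorem hasBochnerIntegral_mul_gammaHalfDensity {z : ℝ} (hz : 0 < z) :
    HasBochnerIntegral (fun v => v * gammaHalfDensity z v) (volume.restrict (Set.Ioi 0))
      (1 / (2 * z)) := by
  have hgamma := (hasBochnerIntegral_rpow_mul_exp_neg_mul (c := 1 / 2) (by norm_num)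
    hz).const_mul (√z / √Real.pi)
  rw [Real.Gamma_add_one (by norm_num), Real.Gamma_one_half_eq, Real.rpow_add_one hz.ne',
    ← Real.sqrt_eq_rpow] at hgamma
  convert! hgamma.congr_ae (g := fun v => v * gammaHalfDensity z v) _ using 1
  · field_simp
  · filter_upwards [ae_restrict_mem measurableSet_Ioi] with v (hv : 0 < v)
    rw [gammaHalfDensity, show (1 / 2 : ℝ) = -(1 / 2) + 1 by norm_num, Real.rpow_add_one hv.ne']
    ring_nf

theorem gammaHalfDensity_le {z v : ℝ} (hz : 0 ≤ z) (hv : 1 ≤ v) :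
    gammaHalfDensity z v ≤ √2 * Real.exp (-(z / 2)) * gammaHalfDensity (z / 2) v := by
  have hsqrt : √z = √2 * √(z / 2) := by rw [← Real.sqrt_mul zero_le_two]; congr 1; ring
  have hexp : Real.exp (-(z * v)) ≤ Real.exp (-(z / 2)) * Real.exp (-(z / 2 * v)) := by
    rw [← Real.exp_add, Real.exp_le_exp]
    nlinarith
  calc gammaHalfDensity z v
      ≤ √2 * √(z / 2) / √Real.pi *
          (v ^ (-(1 / 2) : ℝ) * (Real.exp (-(z / 2)) * Real.exp (-(z / 2 * v)))) := by
        rw [gammaHalfDensity, hsqrt]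
        gcongr
    _ = _ := by rw [gammaHalfDensity]; ring

theorem hasBochnerIntegral_one_sub_pow_mul {b : ℝ} (hb : -1 / 2 < b) (m : ℕ) :
    HasBochnerIntegral (fun v => (1 - v) ^ m * ((1 - v) ^ (b - 1 / 2) * v ^ (-(1 / 2) : ℝ)))
      (volume.restrict (Set.Ioo 0 1)) (√Real.pi * halfShiftGammaRatio b m) := by
  have hbeta := hasBochnerIntegral_rpow_mul_one_sub_rpow (p := 1 / 2) (q := m + (b - 1 / 2) + 1)
    one_half_pos (by linarith [m.cast_nonneg (α := ℝ)])
  rw [ProbabilityTheory.beta, Real.Gamma_one_half_eq, mul_div_assoc,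
    show 1 / 2 + ((m : ℝ) + (b - 1 / 2) + 1) = m + b + 1 by ring] at hbeta
  refine hbeta.congr_ae ?_
  filter_upwards [ae_restrict_mem measurableSet_Ioo] with v hv
  rw [add_sub_cancel_right, Real.rpow_add (sub_pos.2 hv.2), Real.rpow_natCast,
    show ((1 / 2 : ℝ) - 1) = -(1 / 2) by norm_num]
  ring

theorem hasBochnerIntegral_one_sub_rpow_mul_gammaHalfDensity {b z : ℝ} (hb : -1 / 2 < b)
    (hz : 0 ≤ z) :
    HasBochnerIntegral (fun v => (1 - v) ^ (b - 1 / 2) * gammaHalfDensity z v)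
      (volume.restrict (Set.Ioo 0 1)) (modifiedMass b z) := by
  set C := √z * Real.exp (-z) / √Real.pi with hC
  refine HasBochnerIntegral.of_hasSum_of_nonneg
    (fun m => (hasBochnerIntegral_one_sub_pow_mul hb m).const_mul (C * (z ^ m / m.factorial)))
    (fun m => ?_)
    (((hasSum_pow_div_factorial_mul_halfShiftGammaRatio hb hz).mul_left _).congr_fun fun m => ?_)
    (ae_of_all _ fun v => ?_)
  · filter_upwards [ae_restrict_mem measurableSet_Ioo] with v ⟨hv0, hv1⟩
    have hv1' : 0 < 1 - v := sub_pos.2 hv1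
    have := Real.rpow_pos_of_pos hv1' (b - 1 / 2)
    positivity
  · have := (Real.sqrt_pos.2 Real.pi_pos).ne'
    rw [hC]
    field_simp
  · have hexp := (hasSum_pow_div_factorial (z * (1 - v))).mul_left
      (C * ((1 - v) ^ (b - 1 / 2) * v ^ (-(1 / 2) : ℝ)))
    convert! hexp using 1
    · ext m
      rw [mul_pow]
      ring
    · rw [gammaHalfDensity, hC, show -(z * v) = -z + z * (1 - v) by ring, Real.exp_add]
      ring

theorem hasBochnerIntegral_indicator_one_sub_rpow_mul_gammaHalfDensity {b z : ℝ}
    (hb : -1 / 2 < b) (hz : 0 ≤ z) :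
    HasBochnerIntegral
      ((Set.Ioo 0 1).indicator fun v => (1 - v) ^ (b - 1 / 2) * gammaHalfDensity z v)
      (volume.restrict (Set.Ioi 0)) (modifiedMass b z) :=
  (hasBochnerIntegral_one_sub_rpow_mul_gammaHalfDensity hb hz).indicator_restrict
    measurableSet_Ioo Set.Ioo_subset_Ioi_self

theorem modifiedMass_le_one {b z : ℝ} (hb : 1 / 2 ≤ b) (hz : 0 ≤ z) : modifiedMass b z ≤ 1 := by
  rcases hz.eq_or_lt with rfl | hz
  · simp [modifiedMass]
  refine (hasBochnerIntegral_indicator_one_sub_rpow_mul_gammaHalfDensity (by linarith)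
    hz.le).le_of_ae_le (hasBochnerIntegral_gammaHalfDensity hz) ?_
  filter_upwards [ae_restrict_mem measurableSet_Ioi] with v (hv : 0 < v)
  refine Set.indicator_apply_le' (fun hv01 => ?_) fun _ => gammaHalfDensity_nonneg z hv.le
  exact mul_le_of_le_one_left (gammaHalfDensity_nonneg z hv.le)
    (Real.rpow_le_one (by linarith [hv01.2]) (by linarith) (by linarith))

theorem modifiedMass_le_mul_modifiedMass_add_one {b z : ℝ} (hb : -1 / 2 < b) (hz : 0 ≤ z) :
    modifiedMass b z ≤ (b + 1) / (b + 1 / 2) * modifiedMass (b + 1) z := by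
  have hratio (m : ℕ) :
      halfShiftGammaRatio b m ≤ (b + 1) / (b + 1 / 2) * halfShiftGammaRatio (b + 1) m := by
    have : (0 : ℝ) ≤ m := m.cast_nonneg
    rw [halfShiftGammaRatio_add_one hb, ← mul_assoc, div_mul_div_comm]
    refine le_mul_of_one_le_left (halfShiftGammaRatio_pos hb m).le ?_
    rw [one_le_div (mul_pos (by linarith) (by linarith))]
    nlinarith
  rw [modifiedMass, modifiedMass, mul_left_comm]
  refine mul_le_mul_of_nonneg_left (hasSum_le (fun m => ?_)
    (hasSum_pow_div_factorial_mul_halfShiftGammaRatio hb hz)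
    ((hasSum_pow_div_factorial_mul_halfShiftGammaRatio (b := b + 1) (by linarith) hz).mul_left
      ((b + 1) / (b + 1 / 2)))) (by positivity)
  rw [mul_left_comm]
  exact mul_le_mul_of_nonneg_left (hratio m) (by positivity)

theorem modifiedMass_le {b z : ℝ} (hb : -1 / 2 < b) (hz : 0 ≤ z) :
    modifiedMass b z ≤ (b + 1) / (b + 1 / 2) :=
  (modifiedMass_le_mul_modifiedMass_add_one hb hz).trans
    (mul_le_of_le_one_right (div_pos (by linarith) (by linarith)).le
      (modifiedMass_le_one (by linarith) hz))

theorem one_add_mul_le_one_sub_rpow_neg {c v : ℝ} (hc : 0 ≤ c) (hv : v < 1) :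
    1 + c * v ≤ (1 - v) ^ (-c) :=
  calc 1 + c * v ≤ Real.exp (c * v) := by linarith [Real.add_one_le_exp (c * v)]
    _ = Real.exp (-v) ^ (-c) := by rw [← Real.exp_mul]; ring_nf
    _ ≤ (1 - v) ^ (-c) := Real.rpow_le_rpow_of_nonpos (sub_pos.2 hv)
        (by linarith [Real.add_one_le_exp (-v)]) (by linarith)

theorem le_modifiedMass {b z : ℝ} (hb : -1 / 2 < b) (hb' : b ≤ 1 / 2) (hz : 0 < z) :
    1 + (1 / 2 - b) / (2 * z) ≤
      modifiedMass b z + √2 * (1 + (1 / 2 - b)) * Real.exp (-(z / 2)) / z := by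
  set c := 1 / 2 - b with hc
  have hc0 : 0 ≤ c := by linarith
  have hlower := (hasBochnerIntegral_gammaHalfDensity hz).add
    ((hasBochnerIntegral_mul_gammaHalfDensity hz).const_mul c)
  have hupper := (hasBochnerIntegral_indicator_one_sub_rpow_mul_gammaHalfDensity hb hz.le).add
    ((hasBochnerIntegral_mul_gammaHalfDensity (half_pos hz)).const_mul
      (√2 * (1 + c) * Real.exp (-(z / 2))))
  have hle := hlower.le_of_ae_le hupper ?_
  · convert! hle using 1
    · ring
    · field_simp
  filter_upwards [ae_restrict_mem measurableSet_Ioi] with v (hv : 0 < v)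
  rcases lt_or_ge v 1 with hv1 | hv1
  · have hrpow := one_add_mul_le_one_sub_rpow_neg hc0 hv1
    have htail := gammaHalfDensity_nonneg (z / 2) hv.le
    rw [Set.indicator_of_mem (Set.mem_Ioo.2 ⟨hv, hv1⟩), show b - 1 / 2 = -c by rw [hc]; ring]
    calc _ = (1 + c * v) * gammaHalfDensity z v := by ring
      _ ≤ (1 - v) ^ (-c) * gammaHalfDensity z v := by
        gcongr
        exact gammaHalfDensity_nonneg z hv.le
      _ ≤ _ := le_add_of_nonneg_right (by positivity)
  · rw [Set.indicator_of_notMem fun h => hv1.not_gt h.2, zero_add]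
    have htail := gammaHalfDensity_le hz.le hv1
    have := gammaHalfDensity_nonneg z hv.le
    calc _ = (1 + c * v) * gammaHalfDensity z v := by ring
      _ ≤ ((1 + c) * v) * (√2 * Real.exp (-(z / 2)) * gammaHalfDensity (z / 2) v) := by
        gcongr
        linarith
      _ = _ := by ring

theorem eventually_le_modifiedMass {b : ℝ} (hb : -1 / 2 < b) (hb' : b < 1 / 2) :
    ∀ᶠ z in atTop, 1 + (1 / 2 - b) / (4 * z) ≤ modifiedMass b z := by
  set c := 1 / 2 - b with hc
  have hc0 : 0 < c := by linarith
  have hlim : Tendsto (fun z : ℝ => √2 * (1 + c) * Real.exp (-(z / 2))) atTop (𝓝 0) := by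
    simpa using (Real.tendsto_exp_neg_atTop_nhds_zero.comp
      (tendsto_id.atTop_div_const zero_lt_two)).const_mul (√2 * (1 + c))
  filter_upwards [hlim.eventually_lt_const (show 0 < c / 4 by positivity),
    eventually_gt_atTop 0] with z hsmall hz
  have hmass := le_modifiedMass hb hb'.le hz
  have htail : √2 * (1 + c) * Real.exp (-(z / 2)) / z ≤ c / 4 / z := by gcongr
  have hsplit : c / (2 * z) = c / (4 * z) + c / 4 / z := by field_simp; norm_num
  linarith

theorem exists_one_lt_modifiedMass {b : ℝ} (hb : -1 / 2 < b) (hb' : b < 1 / 2) :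
    ∃ κ p, 1 < κ ∧ 0 < p ∧ ∀ z ∈ Set.Ioo p (p + 1), κ ≤ modifiedMass b z := by
  obtain ⟨p, hp⟩ := ((eventually_le_modifiedMass hb hb').and
    (eventually_gt_atTop 0)).exists_forall_of_atTop
  have hp0 : 0 < p := (hp p le_rfl).2
  have : 0 < 1 / 2 - b := by linarith
  have hgap : 0 < (1 / 2 - b) / (4 * (p + 1)) := by positivity
  refine ⟨1 + (1 / 2 - b) / (4 * (p + 1)), p, by linarith, hp0, fun z ⟨hpz, hzp⟩ => ?_⟩
  obtain ⟨hmass, hz⟩ := hp z hpz.le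
  refine le_trans ?_ hmass
  gcongr

/-! ### The variance of the Mehler kernel -/

theorem hasSum_pow_div_factorial_mul (z : ℝ) :
    HasSum (fun m : ℕ => z ^ m / m.factorial * m) (z * Real.exp z) := by
  rw [← hasSum_nat_add_iff' 1]
  simp only [Finset.sum_range_one, Nat.cast_zero, mul_zero, sub_zero]
  refine ((hasSum_pow_div_factorial z).mul_left z).congr_fun fun m => ?_
  rw [Nat.factorial_succ]
  push_cast
  field_simp
  ring

theorem hasSum_pow_div_factorial_mul_mul_sub_one (z : ℝ) :
    HasSum (fun m : ℕ => z ^ m / m.factorial * (m * (m - 1))) (z ^ 2 * Real.exp z) := by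
  rw [← hasSum_nat_add_iff' 1, show z ^ 2 * Real.exp z = z * (z * Real.exp z) by ring]
  simp only [Finset.sum_range_one, Nat.cast_zero, zero_mul, mul_zero, sub_zero]
  refine ((hasSum_pow_div_factorial_mul z).mul_left z).congr_fun fun m => ?_
  rw [Nat.factorial_succ]
  push_cast
  field_simp
  ring

section

variable {a r : ℝ} (ha : -1 < a) (hr0 : 0 ≤ r) (hr : r < 1)
include ha hr0 hr

theorem hasBochnerIntegral_mul_mehlerKernel (x : ℝ) :
    HasBochnerIntegral (fun y => y * mehlerKernel a r x y) (laguerreMeasureReal a)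
      (r * |x| + (1 - r) * (a + 1)) := by
  have h1r : 1 - r ≠ 0 := by linarith
  have hΓ (m : ℕ) : (m : ℝ) + a + 1 ≠ 0 := by linarith [m.cast_nonneg (α := ℝ)]
  have hmehler := hasBochnerIntegral_rpow_mul_iff.2 (hasBochnerIntegral_mehlerKernel (x := x) ha
    (show -1 < a + 1 by linarith) hr0 hr
    (((hasSum_pow_div_factorial_mul (r * |x| / (1 - r))).add
      ((hasSum_pow_div_factorial (r * |x| / (1 - r))).mul_right (a + 1))).congr_fun fun m => by
        rw [← add_assoc, Real.Gamma_add_one (hΓ m),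
          mul_div_cancel_right₀ _ (Gamma_natCast_add_pos ha m).ne']
        ring))
  simp only [Real.rpow_one, add_sub_cancel_left] at hmehler
  convert! hmehler using 1
  rw [Real.exp_neg]
  field_simp

theorem hasBochnerIntegral_sq_mul_mehlerKernel (x : ℝ) :
    HasBochnerIntegral (fun y => y ^ 2 * mehlerKernel a r x y) (laguerreMeasureReal a)
      ((r * |x|) ^ 2 + (2 * a + 4) * (1 - r) * (r * |x|) +
        (1 - r) ^ 2 * ((a + 1) * (a + 2))) := by
  have h1r : 1 - r ≠ 0 := by linarith
  have hΓ (m : ℕ) : 0 < (m : ℝ) + a + 1 := by linarith [m.cast_nonneg (α := ℝ)]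
  have hmehler := hasBochnerIntegral_rpow_mul_iff.2 (hasBochnerIntegral_mehlerKernel (x := x) ha
    (show -1 < a + 2 by linarith) hr0 hr
    (((hasSum_pow_div_factorial_mul_mul_sub_one (r * |x| / (1 - r))).add
      (((hasSum_pow_div_factorial_mul (r * |x| / (1 - r))).mul_right (2 * a + 4)).add
        ((hasSum_pow_div_factorial (r * |x| / (1 - r))).mul_right
          ((a + 1) * (a + 2))))).congr_fun fun m => by
        rw [show (m : ℝ) + (a + 2) + 1 = m + a + 1 + 1 + 1 by ring,
          Real.Gamma_add_one (by linarith [hΓ m]), Real.Gamma_add_one (hΓ m).ne', ← mul_assoc,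
          mul_div_cancel_right₀ _ (Gamma_natCast_add_pos ha m).ne']
        ring))
  simp only [Real.rpow_two, add_sub_cancel_left] at hmehler
  convert! hmehler using 1
  rw [Real.exp_neg]
  field_simp
  ring

/-- The second moment about `x` of the Mehler kernel started at `x ≥ 0`; it measures how fast the
kernel concentrates at `x` as `r → 1`. -/
noncomputable def mehlerSecondMoment (a r x : ℝ) : ℝ :=
  (1 - r) * ((1 - r) * (x ^ 2 + (a + 1) * (a + 2)) + (2 * a + 4) * r * x - 2 * (a + 1) * x)

theorem hasBochnerIntegral_sub_sq_mul_mehlerKernel {x : ℝ} (hx : 0 ≤ x) :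
    HasBochnerIntegral (fun y => (y - x) ^ 2 * mehlerKernel a r x y) (laguerreMeasureReal a)
      (mehlerSecondMoment a r x) := by
  convert! ((hasBochnerIntegral_sq_mul_mehlerKernel ha hr0 hr x).add
    ((hasBochnerIntegral_mul_mehlerKernel ha hr0 hr x).const_mul (-(2 * x)))).add
    ((hasBochnerIntegral_mehlerKernel_self ha hr0 hr x).const_mul (x ^ 2)) using 1
  · ext y
    ring
  · rw [mehlerSecondMoment, abs_of_nonneg hx]
    ring

end

/-! ### Products over coordinates -/

theorem lintegral_fin_prod_eq_prod {n : ℕ} {X : Fin n → Type*} [∀ i, MeasurableSpace (X i)]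
    {μ : ∀ i, Measure (X i)} [∀ i, SigmaFinite (μ i)] {f : ∀ i, X i → ℝ≥0∞}
    (hf : ∀ i, Measurable (f i)) :
    ∫⁻ x, ∏ i, f i (x i) ∂(Measure.pi μ) = ∏ i, ∫⁻ x, f i x ∂(μ i) := by
  induction n with
  | zero => simp
  | succ n ih =>
    have hm : Measurable fun x : ∀ i : Fin n, X i.succ => ∏ i, f i.succ (x i) :=
      Finset.measurable_fun_prod _ fun i _ => (hf _).comp (measurable_pi_apply i)
    have hsplit := (measurePreserving_piFinSuccAbove μ 0).lintegral_comp
      (f := fun p : X 0 × (∀ i : Fin n, X i.succ) => f 0 p.1 * ∏ i, f i.succ (p.2 i))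
      (((hf 0).comp measurable_fst).mul (hm.comp measurable_snd))
    rw [Fin.prod_univ_succ, ← ih fun i => hf _,
      ← lintegral_prod_mul (hf 0).aemeasurable hm.aemeasurable]
    refine Eq.trans (lintegral_congr fun x => ?_) hsplit
    rw [Fin.prod_univ_succ]
    rfl

theorem pi_withDensity {n : ℕ} {X : Fin n → Type*} [∀ i, MeasurableSpace (X i)]
    {μ : ∀ i, Measure (X i)} [∀ i, SigmaFinite (μ i)] {f : ∀ i, X i → ℝ≥0∞}
    (hf : ∀ i, Measurable (f i)) [∀ i, SigmaFinite ((μ i).withDensity (f i))] :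
    Measure.pi (fun i => (μ i).withDensity (f i)) =
      (Measure.pi μ).withDensity fun x => ∏ i, f i (x i) := by
  refine Measure.pi_eq fun s hs => ?_
  have hind : (Set.univ.pi s).indicator (fun x => ∏ i, f i (x i)) =
      fun x => ∏ i, (s i).indicator (f i) (x i) := by
    ext x
    by_cases hx : x ∈ Set.univ.pi s
    · rw [Set.indicator_of_mem hx]
      exact Finset.prod_congr rfl fun i _ => (Set.indicator_of_mem (hx i trivial) _).symm
    · obtain ⟨i, hi⟩ : ∃ i, x i ∉ s i := by simpa using hx
      rw [Set.indicator_of_notMem hx,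
        Finset.prod_eq_zero (Finset.mem_univ i) (Set.indicator_of_notMem hi _)]
  rw [withDensity_apply _ (MeasurableSet.univ_pi hs),
    ← lintegral_indicator (MeasurableSet.univ_pi hs), hind,
    lintegral_fin_prod_eq_prod fun i => (hf i).indicator (hs i)]
  exact Finset.prod_congr rfl fun i _ => by
    rw [lintegral_indicator (hs i), withDensity_apply _ (hs i)]

theorem HasBochnerIntegral.fintype_prod {ι : Type*} [Fintype ι] {X : ι → Type*}
    [∀ i, MeasurableSpace (X i)] {μ : ∀ i, Measure (X i)} [∀ i, SigmaFinite (μ i)]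
    {f : ∀ i, X i → ℝ} {S : ι → ℝ} (hf : ∀ i, HasBochnerIntegral (f i) (μ i) (S i)) :
    HasBochnerIntegral (fun x => ∏ i, f i (x i)) (Measure.pi μ) (∏ i, S i) :=
  ⟨Integrable.fintype_prod_dep fun i => (hf i).1, by
    rw [integral_fintype_prod_eq_prod]
    exact Finset.prod_congr rfl fun i _ => (hf i).2⟩

theorem hasSum_fin_prod {d : ℕ} {ι : Type*} {g : Fin d → ι → ℝ} {S : Fin d → ℝ}
    (hg : ∀ i, HasSum (g i) (S i)) :
    HasSum (fun k : Fin d → ι => ∏ i, g i (k i)) (∏ i, S i) := by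
  induction d with
  | zero => simp
  | succ d ih =>
    have htail := ih fun i => hg i.succ
    let e : ι × (Fin d → ι) ≃ (Fin (d + 1) → ι) := Fin.consEquiv fun _ => ι
    have hmul := summable_mul_of_summable_norm (R := ℝ) (hg 0).summable.abs htail.summable.abs
    rw [← e.hasSum_iff, Fin.prod_univ_succ]
    refine ((hg 0).mul htail hmul).congr_fun fun p => ?_
    rw [Function.comp_apply, Fin.prod_univ_succ]
    rfl

section

variable {d : ℕ} {α : Fin d → ℝ}

theorem posOrthant_eq_pi (d : ℕ) : posOrthant d = Set.univ.pi fun _ => Set.Ioi 0 := by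
  ext x
  simp [posOrthant]

theorem measurableSet_posOrthant (d : ℕ) : MeasurableSet (posOrthant d) :=
  posOrthant_eq_pi d ▸ MeasurableSet.univ_pi fun _ => measurableSet_Ioi

theorem isOpen_posOrthant (d : ℕ) : IsOpen (posOrthant d) :=
  posOrthant_eq_pi d ▸ isOpen_set_pi Set.finite_univ fun _ _ => isOpen_Ioi

theorem laguerreMeasure_eq_pi (α : Fin d → ℝ) :
    laguerreMeasure α = Measure.pi fun i => laguerreMeasureReal (α i) := by
  have (i : Fin d) : SigmaFinite ((volume.restrict (Set.Ioi 0)).withDensity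
      fun y : ℝ => ENNReal.ofReal (y ^ α i * Real.exp (-y))) :=
    inferInstanceAs (SigmaFinite (laguerreMeasureReal (α i)))
  unfold laguerreMeasureReal
  rw [pi_withDensity fun i => by fun_prop, ← Measure.restrict_pi_pi, ← posOrthant_eq_pi,
    ← volume_pi, laguerreMeasure]
  refine withDensity_congr_ae ?_
  filter_upwards [ae_restrict_mem (measurableSet_posOrthant d)] with x hx
  exact ENNReal.ofReal_prod_of_nonneg fun i _ => by
    have := hx i
    positivity

instance (α : Fin d → ℝ) : SigmaFinite (laguerreMeasure α) := by
  rw [laguerreMeasure_eq_pi]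
  infer_instance

theorem isFiniteMeasure_laguerreMeasure (hα : ∀ i, -1 < α i) :
    IsFiniteMeasure (laguerreMeasure α) := by
  have (i : Fin d) : IsFiniteMeasure (laguerreMeasureReal (α i)) :=
    (integrable_const_iff_isFiniteMeasure one_ne_zero).1
      (by simpa using (hasBochnerIntegral_pow (hα i) 0).1)
  rw [laguerreMeasure_eq_pi]
  infer_instance

theorem ae_laguerreMeasure_mem_posOrthant (α : Fin d → ℝ) :
    ∀ᵐ x ∂laguerreMeasure α, x ∈ posOrthant d :=
  (withDensity_absolutelyContinuous _ _).ae_le (ae_restrict_mem (measurableSet_posOrthant d))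

theorem exists_mem_of_ae_laguerreMeasure {P : (Fin d → ℝ) → Prop}
    (hP : ∀ᵐ x ∂laguerreMeasure α, P x) {U : Set (Fin d → ℝ)} (hU : IsOpen U)
    (hne : (U ∩ posOrthant d).Nonempty) : ∃ x ∈ U, P x := by
  rw [laguerreMeasure, ae_withDensity_iff (by fun_prop),
    ae_restrict_iff' (measurableSet_posOrthant d)] at hP
  by_contra! h
  have hnull : ∀ᵐ x : Fin d → ℝ, x ∉ U ∩ posOrthant d := by
    filter_upwards [hP] with x hx hxU
    refine h x hxU.1 (hx hxU.2 (ENNReal.ofReal_ne_zero_iff.2 ?_))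
    exact Finset.prod_pos fun i _ => mul_pos (Real.rpow_pos_of_pos (hxU.2 i) _) (Real.exp_pos _)
  exact ((hU.inter (isOpen_posOrthant d)).measure_pos volume hne).ne' (by
    simpa [ae_iff] using hnull)

theorem laguerreHeatKernel_eq_prod {β : Fin d → ℝ} (hβ : ∀ i, -1 < β i) {t : ℝ} (ht : 0 < t)
    {x y : Fin d → ℝ} (hx : x ∈ posOrthant d) (hy : y ∈ posOrthant d) :
    laguerreHeatKernel β t x y = ∏ i, mehlerKernel (β i) (Real.exp (-t)) (x i) (y i) := by
  have hr : Real.exp (-t) < 1 := Real.exp_lt_one_iff.2 (by linarith)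
  have hprod := hasSum_fin_prod fun i => hasSum_pow_mul_normLaguerre_mul_normLaguerre (hβ i)
    (Real.exp_pos (-t)).le hr (hx i).le (hy i).le
  have hfiber := hasSum_sum_fiber (g := fun k : Fin d → ℕ => ∑ i, k i)
    (s := Finset.piAntidiag Finset.univ) (fun n k => by simp) hprod
  rw [laguerreHeatKernel, ← hfiber.tsum_eq]
  refine tsum_congr fun n => ?_
  rw [Finset.mul_sum]
  refine Finset.sum_congr rfl fun k hk => ?_
  have hkn : ∑ i, k i = n := by simpa using hk
  rw [Finset.prod_mul_distrib, Finset.prod_pow_eq_pow_sum, hkn, Finset.prod_mul_distrib,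
    normLaguerreProd, normLaguerreProd, ← Real.exp_nat_mul, mul_comm (n : ℝ)]

end

/-! ### Integral operators with positive symmetric kernels -/

section KernelOperators

variable {X : Type*} [MeasurableSpace X] {μ : Measure X}

theorem rpow_lintegral_mul_le {w f : X → ℝ≥0∞} (hw : AEMeasurable w μ) (hf : AEMeasurable f μ)
    {c : ℝ≥0∞} (hc : ∫⁻ y, w y ∂μ ≤ c) {p : ℝ} (hp : 1 ≤ p) :
    (∫⁻ y, w y * f y ∂μ) ^ p ≤ c ^ (p - 1) * ∫⁻ y, w y * f y ^ p ∂μ := by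
  have h0 : 0 < p := by linarith
  have hν : μ.withDensity w ≪ μ := withDensity_absolutelyContinuous _ _
  have hweighted {g : X → ℝ≥0∞} (hg : AEMeasurable g μ) :
      ∫⁻ y, g y ∂μ.withDensity w = ∫⁻ y, w y * g y ∂μ :=
    lintegral_withDensity_eq_lintegral_mul₀ hw hg
  have hmass : μ.withDensity w Set.univ ≤ c := by
    rwa [withDensity_apply _ MeasurableSet.univ, Measure.restrict_univ]
  have hjensen := eLpNorm'_le_eLpNorm'_mul_rpow_measure_univ one_pos hp
    (hf.mono_ac hν).aestronglyMeasurable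
  simp only [eLpNorm'_eq_lintegral_enorm, enorm_eq_self, ENNReal.rpow_one, div_one,
    hweighted hf, hweighted (hf.pow_const p)] at hjensen
  refine (ENNReal.rpow_le_rpow hjensen h0.le).trans ?_
  rw [ENNReal.mul_rpow_of_nonneg _ _ h0.le, ← ENNReal.rpow_mul, ← ENNReal.rpow_mul,
    one_div_mul_cancel h0.ne', ENNReal.rpow_one, mul_comm, sub_mul, one_div_mul_cancel h0.ne',
    one_mul]
  gcongr

/-- Measurable, nonnegative, symmetric kernels with integral at most `C` and bounded slices. The
bounds hold at every point, so that integrals against `k x` converge for every `x`. -/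
structure IsSymmKernel (μ : Measure X) (k : X → X → ℝ) (C : ℝ) : Prop where
  measurable : Measurable (Function.uncurry k)
  nonneg : ∀ x y, 0 ≤ k x y
  symm : ∀ x y, k x y = k y x
  integrable : ∀ x, Integrable (k x) μ
  integral_le : ∀ x, ∫ y, k x y ∂μ ≤ C
  bounded : ∀ x, ∃ M, ∀ y, k x y ≤ M

/-- The integral operator with kernel `k`. -/
noncomputable def kernelOp {𝕜 : Type*} [RCLike 𝕜] (μ : Measure X) (k : X → X → ℝ) (f : X → 𝕜)
    (x : X) : 𝕜 :=
  ∫ y, (k x y : 𝕜) * f y ∂μ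

namespace IsSymmKernel

variable {𝕜 : Type*} [RCLike 𝕜] {k : X → X → ℝ} {C : ℝ}

theorem measurable_slice (hk : IsSymmKernel μ k C) (x : X) : Measurable (k x) :=
  hk.measurable.comp measurable_prodMk_left

theorem mono (hk : IsSymmKernel μ k C) {C' : ℝ} (h : C ≤ C') : IsSymmKernel μ k C' :=
  { hk with integral_le := fun x => (hk.integral_le x).trans h }

theorem lintegral_le (hk : IsSymmKernel μ k C) (x : X) :
    ∫⁻ y, ENNReal.ofReal (k x y) ∂μ ≤ ENNReal.ofReal C := by
  rw [← ofReal_integral_eq_lintegral_ofReal (hk.integrable x) (ae_of_all _ (hk.nonneg x))]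
  exact ENNReal.ofReal_le_ofReal (hk.integral_le x)

theorem integrable_mul_of_bound (hk : IsSymmKernel μ k C) (x : X) {f : X → 𝕜}
    (hf : AEStronglyMeasurable f μ) {g : X → ℝ} (hg : Integrable g μ) {B : ℝ}
    (hb : ∀ᵐ y ∂μ, ‖f y‖ ≤ B + g y) (hg0 : ∀ y, 0 ≤ g y) :
    Integrable (fun y => (k x y : 𝕜) * f y) μ := by
  obtain ⟨M, hM⟩ := hk.bounded x
  refine Integrable.mono' (((hk.integrable x).mul_const B).add (hg.const_mul M))
    ((RCLike.measurable_ofReal.comp (hk.measurable_slice x)).aestronglyMeasurable.mul hf) ?_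
  filter_upwards [hb] with y hy
  rw [norm_mul, RCLike.norm_ofReal, abs_of_nonneg (hk.nonneg x y)]
  calc k x y * ‖f y‖ ≤ k x y * (B + g y) := mul_le_mul_of_nonneg_left hy (hk.nonneg x y)
    _ = k x y * B + k x y * g y := mul_add _ _ _
    _ ≤ k x y * B + M * g y := by
      gcongr
      exacts [hg0 y, hM y]

theorem integrable_mul_of_inL1AddLinfty (hk : IsSymmKernel μ k C) (x : X) {f : X → 𝕜}
    (hf : InL1AddLinfty μ f) : Integrable (fun y => (k x y : 𝕜) * f y) μ := by
  obtain ⟨g, h, hg, hh, rfl⟩ := hf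
  refine hk.integrable_mul_of_bound x (hg.1.add hh.1) (memLp_one_iff_integrable.1 hg).norm
    (B := (eLpNorm h ∞ μ).toReal) ?_ fun _ => norm_nonneg _
  filter_upwards [ae_le_eLpNormEssSup (f := h) (μ := μ)] with y hy
  have : ‖h y‖ ≤ (eLpNorm h ∞ μ).toReal := by
    rw [← toReal_enorm]
    refine ENNReal.toReal_mono hh.2.ne ?_
    rwa [eLpNorm_exponent_top]
  exact (norm_add_le _ _).trans (by linarith)

theorem integrable_mul_of_memLp (hk : IsSymmKernel μ k C) (x : X) {p : ℝ≥0∞} (hp : 1 ≤ p)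
    {f : X → 𝕜} (hf : MemLp f p μ) : Integrable (fun y => (k x y : 𝕜) * f y) μ := by
  rcases eq_or_ne p ∞ with rfl | hp'
  · exact hk.integrable_mul_of_inL1AddLinfty x ⟨0, f, MemLp.zero, hf, by simp⟩
  · have h1 : 1 ≤ p.toReal := by simpa using ENNReal.toReal_mono hp' hp
    refine hk.integrable_mul_of_bound x hf.1 (B := 1)
      (hf.integrable_norm_rpow (zero_lt_one.trans_le hp).ne' hp')
      (ae_of_all _ fun y => ?_) (fun y => by positivity)
    rcases le_total ‖f y‖ 1 with h | h
    · exact h.trans (le_add_of_nonneg_right (by positivity))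
    · exact (Real.self_le_rpow_of_one_le h h1).trans (le_add_of_nonneg_left zero_le_one)

theorem enorm_kernelOp_le (hk : IsSymmKernel μ k C) (f : X → 𝕜) (x : X) :
    ‖kernelOp μ k f x‖ₑ ≤ ∫⁻ y, ENNReal.ofReal (k x y) * ‖f y‖ₑ ∂μ := by
  refine (enorm_integral_le_lintegral_enorm _).trans_eq (lintegral_congr fun y => ?_)
  rw [enorm_mul, ← ofReal_norm (k x y : 𝕜), RCLike.norm_ofReal, abs_of_nonneg (hk.nonneg x y)]

theorem eLpNorm_top_kernelOp_le (hk : IsSymmKernel μ k C) (f : X → 𝕜) :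
    eLpNorm (kernelOp μ k f) ∞ μ ≤ ENNReal.ofReal C * eLpNorm f ∞ μ := by
  rw [eLpNorm_exponent_top, eLpNorm_exponent_top]
  refine eLpNormEssSup_le_of_ae_enorm_bound (ae_of_all _ fun x => ?_)
  calc ‖kernelOp μ k f x‖ₑ ≤ ∫⁻ y, ENNReal.ofReal (k x y) * ‖f y‖ₑ ∂μ := hk.enorm_kernelOp_le f x
    _ ≤ ∫⁻ y, ENNReal.ofReal (k x y) * eLpNormEssSup f μ ∂μ := by
      refine lintegral_mono_ae ?_
      filter_upwards [ae_le_eLpNormEssSup (f := f) (μ := μ)] with y hy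
      gcongr
    _ = (∫⁻ y, ENNReal.ofReal (k x y) ∂μ) * eLpNormEssSup f μ :=
      lintegral_mul_const _ (hk.measurable_slice x).ennreal_ofReal
    _ ≤ ENNReal.ofReal C * eLpNormEssSup f μ := by
      gcongr
      exact hk.lintegral_le x

variable [SFinite μ]

theorem aestronglyMeasurable_kernelOp (hk : IsSymmKernel μ k C) {f : X → 𝕜}
    (hf : AEStronglyMeasurable f μ) : AEStronglyMeasurable (kernelOp μ k f) μ :=
  ((RCLike.measurable_ofReal.comp hk.measurable).aestronglyMeasurable.mul
    hf.comp_snd).integral_prod_right'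

theorem lintegral_lintegral_mul_le (hk : IsSymmKernel μ k C) {h : X → ℝ≥0∞}
    (hh : AEMeasurable h μ) :
    ∫⁻ x, ∫⁻ y, ENNReal.ofReal (k x y) * h y ∂μ ∂μ ≤ ENNReal.ofReal C * ∫⁻ y, h y ∂μ :=
  calc ∫⁻ x, ∫⁻ y, ENNReal.ofReal (k x y) * h y ∂μ ∂μ
      = ∫⁻ y, ∫⁻ x, ENNReal.ofReal (k x y) * h y ∂μ ∂μ :=
        lintegral_lintegral_swap (hk.measurable.ennreal_ofReal.aemeasurable.mul hh.comp_snd)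
    _ = ∫⁻ y, (∫⁻ x, ENNReal.ofReal (k y x) ∂μ) * h y ∂μ := by
        refine lintegral_congr fun y => ?_
        rw [← lintegral_mul_const _ (hk.measurable_slice y).ennreal_ofReal]
        exact lintegral_congr fun x => by rw [hk.symm]
    _ ≤ ∫⁻ y, ENNReal.ofReal C * h y ∂μ := by
        gcongr with y
        exact hk.lintegral_le y
    _ = ENNReal.ofReal C * ∫⁻ y, h y ∂μ := lintegral_const_mul' _ _ ENNReal.ofReal_ne_top

theorem lintegral_enorm_kernelOp_rpow_le (hk : IsSymmKernel μ k C) {p : ℝ} (hp : 1 ≤ p)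
    {f : X → 𝕜} (hf : AEStronglyMeasurable f μ) :
    ∫⁻ x, ‖kernelOp μ k f x‖ₑ ^ p ∂μ ≤ ENNReal.ofReal C ^ p * ∫⁻ y, ‖f y‖ₑ ^ p ∂μ :=
  calc ∫⁻ x, ‖kernelOp μ k f x‖ₑ ^ p ∂μ
      ≤ ∫⁻ x, ENNReal.ofReal C ^ (p - 1) *
          ∫⁻ y, ENNReal.ofReal (k x y) * ‖f y‖ₑ ^ p ∂μ ∂μ := by
        gcongr with x
        exact (ENNReal.rpow_le_rpow (hk.enorm_kernelOp_le f x) (by linarith)).trans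
          (rpow_lintegral_mul_le (hk.measurable_slice x).ennreal_ofReal.aemeasurable hf.enorm
            (hk.lintegral_le x) hp)
    _ = ENNReal.ofReal C ^ (p - 1) *
          ∫⁻ x, ∫⁻ y, ENNReal.ofReal (k x y) * ‖f y‖ₑ ^ p ∂μ ∂μ :=
        lintegral_const_mul' _ _
          (ENNReal.rpow_ne_top_of_nonneg (by linarith) ENNReal.ofReal_ne_top)
    _ ≤ ENNReal.ofReal C ^ (p - 1) * (ENNReal.ofReal C ^ (1 : ℝ) * ∫⁻ y, ‖f y‖ₑ ^ p ∂μ) := by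
        rw [ENNReal.rpow_one]
        gcongr
        exact hk.lintegral_lintegral_mul_le (hf.enorm.pow_const p)
    _ = ENNReal.ofReal C ^ p * ∫⁻ y, ‖f y‖ₑ ^ p ∂μ := by
        rw [← mul_assoc, ← ENNReal.rpow_add_of_nonneg _ _ (by linarith) zero_le_one,
          sub_add_cancel]

theorem eLpNorm_kernelOp_le (hk : IsSymmKernel μ k C) {p : ℝ≥0∞} (hp : 1 ≤ p) {f : X → 𝕜}
    (hf : AEStronglyMeasurable f μ) :
    eLpNorm (kernelOp μ k f) p μ ≤ ENNReal.ofReal C * eLpNorm f p μ := by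
  rcases eq_or_ne p ∞ with rfl | hp'
  · exact hk.eLpNorm_top_kernelOp_le f
  · have h1 : 1 ≤ p.toReal := by simpa using ENNReal.toReal_mono hp' hp
    have h0 : 0 < p.toReal := by linarith
    have hp0 : p ≠ 0 := (zero_lt_one.trans_le hp).ne'
    rw [eLpNorm_eq_lintegral_rpow_enorm_toReal hp0 hp',
      eLpNorm_eq_lintegral_rpow_enorm_toReal hp0 hp', one_div, ENNReal.rpow_inv_le_iff h0,
      ENNReal.mul_rpow_of_nonneg _ _ h0.le, ENNReal.rpow_inv_rpow h0.ne']
    exact hk.lintegral_enorm_kernelOp_rpow_le h1 hf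

theorem lpNormLE_kernelOp (hk : IsSymmKernel μ k C) {p : ℝ≥0∞} (hp : 1 ≤ p) :
    LpNormLE μ (kernelOp μ k : (X → 𝕜) → (X → 𝕜)) p C := fun _ hf =>
  ⟨⟨hk.aestronglyMeasurable_kernelOp hf.1, (hk.eLpNorm_kernelOp_le hp hf.1).trans_lt
    (ENNReal.mul_lt_top ENNReal.ofReal_lt_top hf.2)⟩, hk.eLpNorm_kernelOp_le hp hf.1⟩

theorem integrable_prod_mul_mul {k₁ k₂ k₃ : X → X → ℝ} {C₁ C₂ C₃ : ℝ}
    (h₁ : IsSymmKernel μ k₁ C₁) (h₂ : IsSymmKernel μ k₂ C₂) (h₃ : IsSymmKernel μ k₃ C₃) {x : X}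
    (h : ∀ z, HasBochnerIntegral (fun y => k₁ x y * k₂ y z) μ (k₃ x z)) {p : ℝ≥0∞} (hp : 1 ≤ p)
    {f : X → 𝕜} (hf : MemLp f p μ) :
    Integrable (fun q : X × X => ((k₁ x q.1 * k₂ q.1 q.2 : ℝ) : 𝕜) * f q.2) (μ.prod μ) := by
  have hm : AEStronglyMeasurable (fun q : X × X => ((k₁ x q.1 * k₂ q.1 q.2 : ℝ) : 𝕜) * f q.2)
      (μ.prod μ) :=
    (RCLike.measurable_ofReal.comp (((h₁.measurable_slice x).comp measurable_fst).mul
      h₂.measurable)).aestronglyMeasurable.mul hf.1.comp_snd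
  refine (integrable_prod_iff' hm).2 ⟨ae_of_all _ fun z => (h z).1.ofReal.mul_const (f z), ?_⟩
  refine (h₃.integrable_mul_of_memLp x hp hf).norm.congr (ae_of_all _ fun z => ?_)
  simp only [norm_mul, RCLike.norm_ofReal, abs_of_nonneg (h₁.nonneg _ _),
    abs_of_nonneg (h₂.nonneg _ _), abs_of_nonneg (h₃.nonneg _ _), abs_mul, integral_mul_const,
    (h z).2]

theorem kernelOp_comp {k₁ k₂ k₃ : X → X → ℝ} {C₁ C₂ C₃ : ℝ}
    (h₁ : IsSymmKernel μ k₁ C₁) (h₂ : IsSymmKernel μ k₂ C₂) (h₃ : IsSymmKernel μ k₃ C₃) {x : X}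
    (h : ∀ z, HasBochnerIntegral (fun y => k₁ x y * k₂ y z) μ (k₃ x z)) {p : ℝ≥0∞} (hp : 1 ≤ p)
    {f : X → 𝕜} (hf : MemLp f p μ) : kernelOp μ k₃ f x = kernelOp μ k₁ (kernelOp μ k₂ f) x :=
  calc kernelOp μ k₃ f x = ∫ z, ∫ y, ((k₁ x y * k₂ y z : ℝ) : 𝕜) * f z ∂μ ∂μ := by
        simp only [kernelOp, integral_mul_const, integral_ofReal, (h _).2]
    _ = ∫ y, ∫ z, ((k₁ x y * k₂ y z : ℝ) : 𝕜) * f z ∂μ ∂μ :=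
        (integral_integral_swap (integrable_prod_mul_mul h₁ h₂ h₃ h hp hf)).symm
    _ = kernelOp μ k₁ (kernelOp μ k₂ f) x := by
        simp only [kernelOp, ← integral_const_mul, RCLike.ofReal_mul, mul_assoc]

theorem integrable_prod_mul_norm_sq (hk : IsSymmKernel μ k C) {g : X → 𝕜} (hg : MemLp g 2 μ) :
    Integrable (fun q : X × X => k q.1 q.2 * ‖g q.1‖ ^ 2) (μ.prod μ) := by
  have hm : AEStronglyMeasurable (fun q : X × X => k q.1 q.2 * ‖g q.1‖ ^ 2) (μ.prod μ) :=
    hk.measurable.aestronglyMeasurable.mul (hg.1.comp_fst.norm.pow 2)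
  refine (integrable_prod_iff hm).2
    ⟨ae_of_all _ fun x => (hk.integrable x).mul_const (‖g x‖ ^ 2), ?_⟩
  refine Integrable.mono' (hg.integrable_norm_pow two_ne_zero |>.const_mul C)
    hm.norm.integral_prod_right' (ae_of_all _ fun x => ?_)
  have hint : 0 ≤ ∫ y, k x y ∂μ := integral_nonneg (hk.nonneg x)
  simp only [norm_mul, norm_pow, norm_norm, Real.norm_of_nonneg (hk.nonneg _ _),
    integral_mul_const, Real.norm_of_nonneg hint]
  gcongr
  exact hk.integral_le x

theorem integrable_prod_mul_conj (hk : IsSymmKernel μ k C) {f g : X → 𝕜} (hf : MemLp f 2 μ)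
    (hg : MemLp g 2 μ) :
    Integrable (fun q : X × X => g q.1 * ((k q.1 q.2 : 𝕜) * starRingEnd 𝕜 (f q.2)))
      (μ.prod μ) := by
  refine Integrable.mono' ((hk.integrable_prod_mul_norm_sq hg).add
    (hk.integrable_prod_mul_norm_sq hf).swap) (hg.1.comp_fst.mul
      ((RCLike.measurable_ofReal.comp hk.measurable).aestronglyMeasurable.mul
        (RCLike.continuous_conj.comp_aestronglyMeasurable hf.1.comp_snd)))
    (ae_of_all _ fun q => ?_)
  simp only [Pi.add_apply, Function.comp_apply, Prod.fst_swap, Prod.snd_swap, norm_mul,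
    RCLike.norm_ofReal, RCLike.norm_conj, abs_of_nonneg (hk.nonneg _ _), hk.symm q.2 q.1]
  have hamgm : ‖g q.1‖ * ‖f q.2‖ ≤ ‖g q.1‖ ^ 2 + ‖f q.2‖ ^ 2 := by
    nlinarith [sq_nonneg (‖g q.1‖ - ‖f q.2‖), sq_nonneg (‖g q.1‖ + ‖f q.2‖)]
  linarith [mul_le_mul_of_nonneg_left hamgm (hk.nonneg q.1 q.2)]

theorem integral_inner_kernelOp (hk : IsSymmKernel μ k C) {f g : X → 𝕜} (hf : MemLp f 2 μ)
    (hg : MemLp g 2 μ) :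
    ∫ x, inner 𝕜 (kernelOp μ k f x) (g x) ∂μ = ∫ x, inner 𝕜 (f x) (kernelOp μ k g x) ∂μ :=
  calc _ = ∫ x, ∫ y, g x * ((k x y : 𝕜) * starRingEnd 𝕜 (f y)) ∂μ ∂μ := by
        simp only [RCLike.inner_apply, kernelOp, integral_const_mul, ← integral_conj, map_mul,
          RCLike.conj_ofReal]
    _ = ∫ y, ∫ x, g x * ((k x y : 𝕜) * starRingEnd 𝕜 (f y)) ∂μ ∂μ :=
        integral_integral_swap (hk.integrable_prod_mul_conj hf hg)
    _ = _ := by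
        simp only [RCLike.inner_apply, kernelOp, ← integral_mul_const]
        refine integral_congr_ae (ae_of_all _ fun y => integral_congr_ae (ae_of_all _ fun x => ?_))
        simp only [hk.symm x y]
        ring

end IsSymmKernel

end KernelOperators

/-! ### The kernel in product form -/

section ProductKernel

variable {d : ℕ} {α : Fin d → ℝ} {j : Fin d} {r s : ℝ}

/-- The `d`-dimensional Mehler kernel: the tensor product of the one-dimensional ones. -/
noncomputable def mehlerProdKernel (β : Fin d → ℝ) (r : ℝ) (x y : Fin d → ℝ) : ℝ :=
  ∏ i, mehlerKernel (β i) r (x i) (y i)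

/-- The one-dimensional factors of the modified kernel: the modified Mehler kernel in the `j`-th
coordinate and the Mehler kernel in the others. -/
noncomputable def modifiedFactor (α : Fin d → ℝ) (j : Fin d) (r : ℝ) (i : Fin d) (x y : ℝ) : ℝ :=
  if i = j then modifiedMehlerKernel (α i) r x y else mehlerKernel (α i) r x y

/-- The kernel `modifiedKernel α j t`, with `r = e^{-t}`, as a product over the coordinates. Unlike
the defining series it makes sense, with the same bounds, at all points of the space. -/
noncomputable def modifiedProdKernel (α : Fin d → ℝ) (j : Fin d) (r : ℝ) (x y : Fin d → ℝ) : ℝ :=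
  ∏ i, modifiedFactor α j r i (x i) (y i)

theorem IsAdmissible.neg_one_lt_add_single (hα : IsAdmissible α j) (i : Fin d) :
    -1 < (α + Pi.single j 1 : Fin d → ℝ) i := by
  rcases eq_or_ne i j with rfl | h
  · simpa using by linarith [hα.1]
  · simpa [h] using hα.2 i h

theorem modifiedProdKernel_eq (α : Fin d → ℝ) (j : Fin d) (r : ℝ) (x y : Fin d → ℝ) :
    modifiedProdKernel α j r x y =
      r * (√|x j| * √|y j| * mehlerProdKernel (α + Pi.single j 1) r x y) := by
  have hfactor (i : Fin d) : modifiedFactor α j r i (x i) (y i) =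
      (if i = j then r * (√|x i| * √|y i|) else 1) *
        mehlerKernel ((α + Pi.single j 1 : Fin d → ℝ) i) r (x i) (y i) := by
    rcases eq_or_ne i j with rfl | h
    · simp [modifiedFactor, modifiedMehlerKernel, mul_assoc]
    · simp [modifiedFactor, h]
  simp only [modifiedProdKernel, hfactor, Finset.prod_mul_distrib, Finset.prod_ite_eq',
    Finset.mem_univ, if_true, mehlerProdKernel, mul_assoc]

theorem modifiedKernel_eq_modifiedProdKernel (hα : IsAdmissible α j) {t : ℝ} (ht : 0 < t)
    {x y : Fin d → ℝ} (hx : x ∈ posOrthant d) (hy : y ∈ posOrthant d) :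
    modifiedKernel α j t x y = modifiedProdKernel α j (Real.exp (-t)) x y := by
  rw [modifiedKernel, laguerreHeatKernel_eq_prod hα.neg_one_lt_add_single ht hx hy,
    modifiedProdKernel_eq, mehlerProdKernel, abs_of_pos (hx j), abs_of_pos (hy j),
    Real.sqrt_mul (hx j).le]

theorem modifiedFactor_nonneg (hα : IsAdmissible α j) (hr0 : 0 ≤ r) (hr : r < 1) (i : Fin d)
    (x y : ℝ) : 0 ≤ modifiedFactor α j r i x y := by
  unfold modifiedFactor modifiedMehlerKernel
  split_ifs with h
  · subst h
    have := mehlerKernel_nonneg (a := α i + 1) (by linarith [hα.1]) hr0 hr x y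
    positivity
  · exact mehlerKernel_nonneg (hα.2 i h) hr0 hr x y

theorem modifiedFactor_symm (α : Fin d → ℝ) (j : Fin d) (r : ℝ) (i : Fin d) (x y : ℝ) :
    modifiedFactor α j r i x y = modifiedFactor α j r i y x := by
  simp only [modifiedFactor, modifiedMehlerKernel, mehlerKernel_symm _ r x y, mul_comm √|x|]

theorem measurable_modifiedFactor (α : Fin d → ℝ) (j : Fin d) (r : ℝ) (i : Fin d) :
    Measurable fun p : ℝ × ℝ => modifiedFactor α j r i p.1 p.2 := by
  have := measurable_mehlerKernel (α i) r
  have := measurable_mehlerKernel (α i + 1) r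
  unfold modifiedFactor modifiedMehlerKernel
  split_ifs <;> fun_prop

theorem exists_modifiedFactor_le (hα : IsAdmissible α j) (hr0 : 0 < r) (hr : r < 1) (i : Fin d)
    (x : ℝ) : ∃ M, ∀ y, modifiedFactor α j r i x y ≤ M := by
  unfold modifiedFactor modifiedMehlerKernel
  split_ifs with h
  · subst h
    obtain ⟨M, hM⟩ := exists_sqrt_mul_mehlerKernel_le (a := α i + 1) (by linarith [hα.1]) hr0 hr x
    refine ⟨r * (√|x| * M), fun y => ?_⟩
    rw [mul_assoc √|x|]
    gcongr
    exact hM y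
  · exact exists_mehlerKernel_le (hα.2 i h) hr0 hr x

theorem hasBochnerIntegral_modifiedFactor (hα : IsAdmissible α j) (hr0 : 0 ≤ r) (hr : r < 1)
    (i : Fin d) (x : ℝ) :
    HasBochnerIntegral (modifiedFactor α j r i x) (laguerreMeasureReal (α i))
      (if i = j then √r * modifiedMass (α i + 1) (r * |x| / (1 - r)) else 1) := by
  unfold modifiedFactor
  split_ifs with h
  · subst h
    exact hasBochnerIntegral_modifiedMehlerKernel hα.1 hr0 hr x
  · exact hasBochnerIntegral_mehlerKernel_self (hα.2 i h) hr0 hr x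

theorem hasBochnerIntegral_modifiedFactor_mul_modifiedFactor (hα : IsAdmissible α j)
    (hr0 : 0 ≤ r) (hr : r < 1) (hs0 : 0 ≤ s) (hs : s < 1) (i : Fin d) (x z : ℝ) :
    HasBochnerIntegral (fun y => modifiedFactor α j r i x y * modifiedFactor α j s i y z)
      (laguerreMeasureReal (α i)) (modifiedFactor α j (r * s) i x z) := by
  unfold modifiedFactor
  split_ifs with h
  · subst h
    exact hasBochnerIntegral_modifiedMehlerKernel_mul_modifiedMehlerKernel (by linarith [hα.1])
      hr0 hr hs0 hs x z
  · exact hasBochnerIntegral_mehlerKernel_mul_mehlerKernel (hα.2 i h) hr0 hr hs0 hs x z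

theorem measurable_modifiedProdKernel (α : Fin d → ℝ) (j : Fin d) (r : ℝ) :
    Measurable (Function.uncurry (modifiedProdKernel α j r)) := by
  unfold Function.uncurry modifiedProdKernel
  refine Finset.measurable_fun_prod _ fun i _ => ?_
  exact (measurable_modifiedFactor α j r i).comp
    (f := fun p : (Fin d → ℝ) × (Fin d → ℝ) => (p.1 i, p.2 i)) (by fun_prop)

theorem exists_modifiedProdKernel_le (hα : IsAdmissible α j) (hr0 : 0 < r) (hr : r < 1)
    (x : Fin d → ℝ) : ∃ M, ∀ y, modifiedProdKernel α j r x y ≤ M := by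
  choose M hM using fun i => exists_modifiedFactor_le hα hr0 hr i (x i)
  exact ⟨∏ i, M i, fun y => Finset.prod_le_prod
    (fun i _ => modifiedFactor_nonneg hα hr0.le hr i _ _) fun i _ => hM i _⟩

theorem hasBochnerIntegral_modifiedProdKernel (hα : IsAdmissible α j) (hr0 : 0 ≤ r) (hr : r < 1)
    (x : Fin d → ℝ) : HasBochnerIntegral (modifiedProdKernel α j r x) (laguerreMeasure α)
      (√r * modifiedMass (α j + 1) (r * |x j| / (1 - r))) := by
  rw [laguerreMeasure_eq_pi]
  unfold modifiedProdKernel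
  simpa only [Finset.prod_ite_eq', Finset.mem_univ, if_true] using
    HasBochnerIntegral.fintype_prod fun i => hasBochnerIntegral_modifiedFactor hα hr0 hr i (x i)

theorem hasBochnerIntegral_modifiedProdKernel_mul_modifiedProdKernel (hα : IsAdmissible α j)
    (hr0 : 0 ≤ r) (hr : r < 1) (hs0 : 0 ≤ s) (hs : s < 1) (x z : Fin d → ℝ) :
    HasBochnerIntegral (fun y => modifiedProdKernel α j r x y * modifiedProdKernel α j s y z)
      (laguerreMeasure α) (modifiedProdKernel α j (r * s) x z) := by
  rw [laguerreMeasure_eq_pi]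
  unfold modifiedProdKernel
  simpa only [← Finset.prod_mul_distrib] using HasBochnerIntegral.fintype_prod fun i =>
    hasBochnerIntegral_modifiedFactor_mul_modifiedFactor hα hr0 hr hs0 hs i (x i) (z i)

theorem isSymmKernel_modifiedProdKernel (hα : IsAdmissible α j) (hr0 : 0 < r) (hr : r < 1)
    {c : ℝ} (hc : ∀ z, 0 ≤ z → modifiedMass (α j + 1) z ≤ c) :
    IsSymmKernel (laguerreMeasure α) (modifiedProdKernel α j r) (√r * c) where
  measurable := measurable_modifiedProdKernel α j r
  nonneg x y := Finset.prod_nonneg fun i _ => modifiedFactor_nonneg hα hr0.le hr i _ _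
  symm x y := Finset.prod_congr rfl fun i _ => modifiedFactor_symm α j r i _ _
  integrable x := (hasBochnerIntegral_modifiedProdKernel hα hr0.le hr x).1
  integral_le x := by
    have : 0 < 1 - r := by linarith
    rw [(hasBochnerIntegral_modifiedProdKernel hα hr0.le hr x).2]
    exact mul_le_mul_of_nonneg_left (hc _ (by positivity)) (Real.sqrt_nonneg r)
  bounded := exists_modifiedProdKernel_le hα hr0 hr

theorem modifiedSemigroup_eq_kernelOp {𝕜 : Type*} [RCLike 𝕜] (hα : IsAdmissible α j) {t : ℝ}
    (ht : 0 < t) (f : (Fin d → ℝ) → 𝕜) {x : Fin d → ℝ} (hx : x ∈ posOrthant d) :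
    modifiedSemigroup 𝕜 α j t f x =
      kernelOp (laguerreMeasure α) (modifiedProdKernel α j (Real.exp (-t))) f x := by
  rw [modifiedSemigroup, if_neg ht.ne', kernelOp]
  refine integral_congr_ae ?_
  filter_upwards [ae_laguerreMeasure_mem_posOrthant α] with y hy
  rw [modifiedKernel_eq_modifiedProdKernel hα ht hx hy]

theorem modifiedSemigroup_ae_eq {𝕜 : Type*} [RCLike 𝕜] (hα : IsAdmissible α j) {t : ℝ}
    (ht : 0 < t) (f : (Fin d → ℝ) → 𝕜) : modifiedSemigroup 𝕜 α j t f =ᵐ[laguerreMeasure α]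
      kernelOp (laguerreMeasure α) (modifiedProdKernel α j (Real.exp (-t))) f := by
  filter_upwards [ae_laguerreMeasure_mem_posOrthant α] with x hx
  exact modifiedSemigroup_eq_kernelOp hα ht f hx

end ProductKernel

/-! ### Approximate identities -/

section Approximation

variable {E : Type*} [NormedAddCommGroup E]

theorem exists_norm_sub_le_add_mul_sum_sq {d : ℕ} {h : (Fin d → ℝ) → E} {M : ℝ}
    (hM : ∀ y, ‖h y‖ ≤ M) {x : Fin d → ℝ} (hc : ContinuousAt h x) {ε : ℝ} (hε : 0 < ε) :
    ∃ C, ∀ y, ‖h y - h x‖ ≤ ε + C * ∑ i, (y i - x i) ^ 2 := by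
  have hM0 : 0 ≤ M := (norm_nonneg _).trans (hM x)
  obtain ⟨δ, hδ, hnear⟩ := Metric.continuousAt_iff.1 hc ε hε
  refine ⟨2 * M / δ ^ 2, fun y => ?_⟩
  rcases lt_or_ge (dist y x) δ with hy | hy
  · have : 0 ≤ 2 * M / δ ^ 2 * ∑ i, (y i - x i) ^ 2 := by positivity
    linarith [dist_eq_norm (h y) (h x), hnear hy]
  · obtain ⟨i, hi⟩ : ∃ i, δ ≤ |y i - x i| := by
      by_contra! hfar
      exact hy.not_gt ((dist_pi_lt_iff hδ).2 hfar)
    have hsum : δ ^ 2 ≤ ∑ i, (y i - x i) ^ 2 :=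
      calc δ ^ 2 ≤ |y i - x i| ^ 2 := by gcongr
        _ = (y i - x i) ^ 2 := sq_abs _
        _ ≤ ∑ i, (y i - x i) ^ 2 :=
          Finset.single_le_sum (f := fun i => (y i - x i) ^ 2) (fun i _ => sq_nonneg _)
            (Finset.mem_univ i)
    have hfar : 2 * M ≤ 2 * M / δ ^ 2 * ∑ i, (y i - x i) ^ 2 := by
      rw [div_mul_eq_mul_div, le_div_iff₀ (by positivity)]
      gcongr
    linarith [norm_sub_le (h y) (h x), hM y, hM x]

variable [NormedSpace ℝ E]

theorem norm_integral_smul_sub_le [CompleteSpace E] {X : Type*} [MeasurableSpace X]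
    {μ : Measure X} {k q : X → ℝ} {V ε C : ℝ} (hk0 : ∀ y, 0 ≤ k y) (hk : HasBochnerIntegral k μ 1)
    (hq : HasBochnerIntegral (fun y => q y * k y) μ V) {h : X → E}
    (hm : AEStronglyMeasurable h μ) {v : E} (hb : ∀ y, ‖h y - v‖ ≤ ε + C * q y) :
    ‖∫ y, k y • h y ∂μ - v‖ ≤ ε + C * V := by
  have hmajorant := (hk.const_mul ε).add (hq.const_mul C)
  rw [mul_one] at hmajorant
  have hle (y : X) : ‖k y • (h y - v)‖ ≤ ε * k y + C * (q y * k y) := by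
    rw [norm_smul, Real.norm_of_nonneg (hk0 y)]
    linarith [mul_le_mul_of_nonneg_left (hb y) (hk0 y)]
  have hint : Integrable (fun y => k y • (h y - v)) μ :=
    hmajorant.1.mono' (hk.1.1.smul (hm.sub aestronglyMeasurable_const)) (ae_of_all _ hle)
  have hconst : ∫ y, k y • v ∂μ = v := by rw [integral_smul_const, hk.2, one_smul]
  have hsplit : ∫ y, k y • h y ∂μ = ∫ y, k y • (h y - v) ∂μ + ∫ y, k y • v ∂μ := by
    rw [← integral_add hint (hk.1.smul_const v)]
    simp only [smul_sub, sub_add_cancel]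
  rw [hsplit, hconst, add_sub_cancel_right, ← hmajorant.2]
  exact norm_integral_le_of_norm_le hmajorant.1 (ae_of_all _ hle)

variable {d : ℕ} {β : Fin d → ℝ} {r : ℝ}

theorem mehlerProdKernel_nonneg (hβ : ∀ i, -1 < β i) (hr0 : 0 ≤ r) (hr : r < 1)
    (x y : Fin d → ℝ) : 0 ≤ mehlerProdKernel β r x y :=
  Finset.prod_nonneg fun i _ => mehlerKernel_nonneg (hβ i) hr0 hr _ _

theorem hasBochnerIntegral_mehlerProdKernel (hβ : ∀ i, -1 < β i) (hr0 : 0 ≤ r) (hr : r < 1)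
    (x : Fin d → ℝ) : HasBochnerIntegral (mehlerProdKernel β r x) (laguerreMeasure β) 1 := by
  rw [laguerreMeasure_eq_pi]
  unfold mehlerProdKernel
  simpa only [Finset.prod_const_one] using HasBochnerIntegral.fintype_prod fun i =>
    hasBochnerIntegral_mehlerKernel_self (hβ i) hr0 hr (x i)

theorem hasBochnerIntegral_sub_sq_mul_mehlerProdKernel (hβ : ∀ i, -1 < β i) (hr0 : 0 ≤ r)
    (hr : r < 1) {x : Fin d → ℝ} (hx : x ∈ posOrthant d) (i : Fin d) :
    HasBochnerIntegral (fun y => (y i - x i) ^ 2 * mehlerProdKernel β r x y) (laguerreMeasure β)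
      (mehlerSecondMoment (β i) r (x i)) := by
  have hfactor (l : Fin d) : HasBochnerIntegral
      (fun y => (if l = i then (y - x l) ^ 2 else 1) * mehlerKernel (β l) r (x l) y)
      (laguerreMeasureReal (β l)) (if l = i then mehlerSecondMoment (β l) r (x l) else 1) := by
    split_ifs
    · exact hasBochnerIntegral_sub_sq_mul_mehlerKernel (hβ l) hr0 hr (hx l).le
    · simpa only [one_mul] using hasBochnerIntegral_mehlerKernel_self (hβ l) hr0 hr (x l)
  rw [laguerreMeasure_eq_pi]
  unfold mehlerProdKernel
  simpa only [Finset.prod_mul_distrib, Finset.prod_ite_eq', Finset.mem_univ, if_true] using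
    HasBochnerIntegral.fintype_prod hfactor

theorem tendsto_integral_mehlerProdKernel_smul [CompleteSpace E] (hβ : ∀ i, -1 < β i)
    {x : Fin d → ℝ} (hx : x ∈ posOrthant d) {h : (Fin d → ℝ) → E}
    (hm : AEStronglyMeasurable h (laguerreMeasure β)) {M : ℝ} (hM : ∀ y, ‖h y‖ ≤ M)
    (hc : ContinuousAt h x) :
    Tendsto (fun r => ∫ y, mehlerProdKernel β r x y • h y ∂laguerreMeasure β) (𝓝[<] 1)
      (𝓝 (h x)) := by
  rw [Metric.tendsto_nhds]
  intro ε hε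
  obtain ⟨C, hC⟩ := exists_norm_sub_le_add_mul_sum_sq hM hc (half_pos hε)
  have hlim : Tendsto (fun r => ε / 2 + C * ∑ i, mehlerSecondMoment (β i) r (x i)) (𝓝[<] 1)
      (𝓝 (ε / 2)) := by
    have hcont : Continuous fun r => ε / 2 + C * ∑ i, mehlerSecondMoment (β i) r (x i) := by
      unfold mehlerSecondMoment
      fun_prop
    simpa [mehlerSecondMoment] using (hcont.tendsto 1).mono_left nhdsWithin_le_nhds
  filter_upwards [hlim.eventually_lt_const (half_lt_self hε), Ioo_mem_nhdsLT zero_lt_one]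
    with r hsmall ⟨hr0, hr1⟩
  have hsecond := HasBochnerIntegral.finset_sum Finset.univ fun i _ =>
    hasBochnerIntegral_sub_sq_mul_mehlerProdKernel hβ hr0.le hr1 hx i
  simp only [← Finset.sum_mul] at hsecond
  rw [dist_eq_norm]
  exact (norm_integral_smul_sub_le (mehlerProdKernel_nonneg hβ hr0.le hr1 x)
    (hasBochnerIntegral_mehlerProdKernel hβ hr0.le hr1 x) hsecond hm hC).trans_lt hsmall

end Approximation

theorem integral_laguerreMeasure_add_single {d : ℕ} {E : Type*} [NormedAddCommGroup E]
    [NormedSpace ℝ E] (α : Fin d → ℝ) (j : Fin d) (f : (Fin d → ℝ) → E) :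
    ∫ y, f y ∂laguerreMeasure (α + Pi.single j 1) = ∫ y, y j • f y ∂laguerreMeasure α := by
  rw [laguerreMeasure, laguerreMeasure,
    integral_withDensity_eq_integral_toReal_smul (by fun_prop) (by simp),
    integral_withDensity_eq_integral_toReal_smul (by fun_prop) (by simp)]
  refine integral_congr_ae ?_
  filter_upwards [ae_restrict_mem (measurableSet_posOrthant d)] with y hy
  have hpos (γ : Fin d → ℝ) : 0 ≤ ∏ i, y i ^ γ i * Real.exp (-y i) :=
    Finset.prod_nonneg fun i _ => mul_nonneg (Real.rpow_nonneg (hy i).le _) (Real.exp_pos _).le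
  have hfactor (i : Fin d) : y i ^ (α + Pi.single j 1 : Fin d → ℝ) i * Real.exp (-y i) =
      (y i ^ α i * Real.exp (-y i)) * if i = j then y i else 1 := by
    rcases eq_or_ne i j with rfl | h
    · simp only [Pi.add_apply, Pi.single_eq_same, Real.rpow_add_one (hy i).ne', if_true]
      ring
    · simp [h]
  rw [ENNReal.toReal_ofReal (hpos _), ENNReal.toReal_ofReal (hpos _), smul_smul]
  simp only [hfactor, Finset.prod_mul_distrib, Finset.prod_ite_eq', Finset.mem_univ, if_true]

/-! ### Strong continuity -/

theorem tendsto_eLpNorm_zero_of_norm_le {X ι E : Type*} [MeasurableSpace X] {μ : Measure X}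
    [IsFiniteMeasure μ] [NormedAddCommGroup E] {l : Filter ι} [l.IsCountablyGenerated]
    {F : ι → X → E} {B : ℝ} (hm : ∀ᶠ i in l, AEStronglyMeasurable (F i) μ)
    (hB : ∀ᶠ i in l, ∀ x, ‖F i x‖ ≤ B) (hlim : ∀ᵐ x ∂μ, Tendsto (fun i => F i x) l (𝓝 0))
    {p : ℝ≥0∞} (hp0 : p ≠ 0) (hp : p ≠ ∞) : Tendsto (fun i => eLpNorm (F i) p μ) l (𝓝 0) := by
  have hp' : 0 < p.toReal := ENNReal.toReal_pos hp0 hp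
  have hlintegral : Tendsto (fun i => ∫⁻ x, ‖F i x‖ₑ ^ p.toReal ∂μ) l (𝓝 (∫⁻ _, 0 ∂μ)) := by
    refine tendsto_lintegral_filter_of_dominated_convergence'
      (fun _ => ENNReal.ofReal B ^ p.toReal) (hm.mono fun i hi => hi.enorm.pow_const _)
      (hB.mono fun i hi => ae_of_all _ fun x => ?_) ?_ (hlim.mono fun x hx => ?_)
    · rw [← ofReal_norm]
      gcongr
      exact hi x
    · rw [lintegral_const]
      finiteness
    · simpa [hp'] using hx.enorm.ennrpow_const p.toReal
  rw [lintegral_zero] at hlintegral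
  simpa [eLpNorm_eq_lintegral_rpow_enorm_toReal hp0 hp, hp'] using
    hlintegral.ennrpow_const (1 / p.toReal)

namespace IsSymmKernel

variable {X ι 𝕜 : Type*} [MeasurableSpace X] {μ : Measure X} [RCLike 𝕜] {k : X → X → ℝ} {C : ℝ}

theorem norm_kernelOp_le (hk : IsSymmKernel μ k C) {f : X → 𝕜} {B : ℝ} (hB : ∀ y, ‖f y‖ ≤ B)
    (x : X) : ‖kernelOp μ k f x‖ ≤ C * B := by
  refine (norm_integral_le_of_norm_le ((hk.integrable x).mul_const B)
    (ae_of_all _ fun y => ?_)).trans ?_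
  · rw [norm_mul, RCLike.norm_ofReal, abs_of_nonneg (hk.nonneg x y)]
    exact mul_le_mul_of_nonneg_left (hB y) (hk.nonneg x y)
  · rw [integral_mul_const]
    exact mul_le_mul_of_nonneg_right (hk.integral_le x) ((norm_nonneg _).trans (hB x))

theorem kernelOp_sub (hk : IsSymmKernel μ k C) {p : ℝ≥0∞} (hp : 1 ≤ p) {f g : X → 𝕜}
    (hf : MemLp f p μ) (hg : MemLp g p μ) :
    kernelOp μ k (f - g) = kernelOp μ k f - kernelOp μ k g := by
  ext x
  simp only [kernelOp, Pi.sub_apply, mul_sub]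
  exact integral_sub (hk.integrable_mul_of_memLp x hp hf) (hk.integrable_mul_of_memLp x hp hg)

theorem eLpNorm_kernelOp_sub_le [SFinite μ] (hk : IsSymmKernel μ k C) {p : ℝ≥0∞} (hp : 1 ≤ p)
    {f g : X → 𝕜} (hf : MemLp f p μ) (hg : MemLp g p μ) :
    eLpNorm (kernelOp μ k f - f) p μ ≤
      (ENNReal.ofReal C + 1) * eLpNorm (f - g) p μ + eLpNorm (kernelOp μ k g - g) p μ := by
  have hfg := hf.sub hg
  have hTg := (hk.lpNormLE_kernelOp hp g hg).1
  obtain ⟨hTfg, hle⟩ := hk.lpNormLE_kernelOp hp (f - g) hfg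
  calc eLpNorm (kernelOp μ k f - f) p μ
      = eLpNorm (kernelOp μ k (f - g) - (f - g) + (kernelOp μ k g - g)) p μ := by
        rw [hk.kernelOp_sub hp hf hg]
        abel_nf
    _ ≤ eLpNorm (kernelOp μ k (f - g)) p μ + eLpNorm (f - g) p μ +
          eLpNorm (kernelOp μ k g - g) p μ :=
        (eLpNorm_add_le (hTfg.1.sub hfg.1) (hTg.1.sub hg.1) hp).trans
          (add_le_add_left (eLpNorm_sub_le hTfg.1 hfg.1 hp) _)
    _ ≤ _ := by
        rw [add_mul, one_mul]
        gcongr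

theorem tendsto_eLpNorm_kernelOp_sub_of_approx [SFinite μ] {l : Filter ι} {k : ι → X → X → ℝ}
    (hk : ∀ᶠ i in l, IsSymmKernel μ (k i) C) {p : ℝ≥0∞} (hp : 1 ≤ p) {f : X → 𝕜}
    (hf : MemLp f p μ) (happrox : ∀ ε : ℝ≥0∞, ε ≠ 0 → ∃ g : X → 𝕜, MemLp g p μ ∧
      eLpNorm (f - g) p μ ≤ ε ∧ Tendsto (fun i => eLpNorm (kernelOp μ (k i) g - g) p μ) l (𝓝 0)) :
    Tendsto (fun i => eLpNorm (kernelOp μ (k i) f - f) p μ) l (𝓝 0) := by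
  rw [ENNReal.tendsto_nhds_zero]
  intro ε hε
  have hδ : ε / (ENNReal.ofReal C + 2) ≠ 0 := (ENNReal.div_pos hε.ne' (by finiteness)).ne'
  obtain ⟨g, hg, hfg, hlim⟩ := happrox _ hδ
  filter_upwards [hk, ENNReal.tendsto_nhds_zero.1 hlim _ hδ.bot_lt] with i hki hgi
  calc eLpNorm (kernelOp μ (k i) f - f) p μ
      ≤ (ENNReal.ofReal C + 1) * (ε / (ENNReal.ofReal C + 2)) + ε / (ENNReal.ofReal C + 2) :=
        (hki.eLpNorm_kernelOp_sub_le hp hf hg).trans (by gcongr)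
    _ = (ENNReal.ofReal C + 2) * (ε / (ENNReal.ofReal C + 2)) := by ring
    _ = ε := ENNReal.mul_div_cancel (by positivity) (by finiteness)

end IsSymmKernel

section StrongContinuity

variable {𝕜 : Type*} [RCLike 𝕜] {d : ℕ} {α : Fin d → ℝ} {j : Fin d}

theorem kernelOp_modifiedProdKernel_eq (α : Fin d → ℝ) (j : Fin d) (r : ℝ)
    (g : (Fin d → ℝ) → 𝕜) {x : Fin d → ℝ} (hx : x ∈ posOrthant d) :
    kernelOp (laguerreMeasure α) (modifiedProdKernel α j r) g x =
      (r * √(x j)) • ∫ y, mehlerProdKernel (α + Pi.single j 1) r x y • ((√(y j))⁻¹ • g y)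
        ∂laguerreMeasure (α + Pi.single j 1) := by
  rw [integral_laguerreMeasure_add_single, ← integral_smul, kernelOp]
  refine integral_congr_ae ?_
  filter_upwards [ae_laguerreMeasure_mem_posOrthant α] with y hy
  rw [modifiedProdKernel_eq, abs_of_pos (hx j), abs_of_pos (hy j), ← RCLike.real_smul_eq_coe_mul,
    smul_smul, smul_smul, smul_smul]
  congr 1
  have hy' : √(y j) ≠ 0 := (Real.sqrt_pos.2 (hy j)).ne'
  nth_rw 2 [← Real.mul_self_sqrt (hy j).le]
  field_simp

theorem tendsto_kernelOp_modifiedProdKernel (hα : IsAdmissible α j) {x : Fin d → ℝ}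
    (hx : x ∈ posOrthant d) {g : (Fin d → ℝ) → 𝕜} (hg : Continuous g) {M : ℝ}
    (hM : ∀ y, ‖g y‖ ≤ M * √(y j)) :
    Tendsto (fun r => kernelOp (laguerreMeasure α) (modifiedProdKernel α j r) g x) (𝓝[<] 1)
      (𝓝 (g x)) := by
  have hs : 0 < √(x j) := Real.sqrt_pos.2 (hx j)
  have hM0 : 0 ≤ M := nonneg_of_mul_nonneg_left ((norm_nonneg _).trans (hM x)) hs
  have hbound (y : Fin d → ℝ) : ‖(√(y j))⁻¹ • g y‖ ≤ M := by
    rw [norm_smul, Real.norm_of_nonneg (by positivity), inv_mul_eq_div]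
    exact div_le_of_le_mul₀ (Real.sqrt_nonneg _) hM0 (hM y)
  have hmeas : AEStronglyMeasurable (fun y => (√(y j))⁻¹ • g y)
      (laguerreMeasure (α + Pi.single j 1)) :=
    (Measurable.aestronglyMeasurable (by fun_prop)).smul hg.aestronglyMeasurable
  have hinv : ContinuousAt (fun y : Fin d → ℝ => (√(y j))⁻¹) x :=
    (continuous_apply j).sqrt.continuousAt.inv₀ hs.ne'
  have hcont : ContinuousAt (fun y => (√(y j))⁻¹ • g y) x := hinv.smul hg.continuousAt
  have hprefactor : Tendsto (fun r : ℝ => r * √(x j)) (𝓝[<] 1) (𝓝 (1 * √(x j))) :=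
    ((continuous_id.mul continuous_const).tendsto 1).mono_left nhdsWithin_le_nhds
  have hlim := hprefactor.smul (tendsto_integral_mehlerProdKernel_smul
    hα.neg_one_lt_add_single hx hmeas hbound hcont)
  rw [one_mul, smul_smul, mul_inv_cancel₀ hs.ne', one_smul] at hlim
  simpa only [fun r => kernelOp_modifiedProdKernel_eq α j r g hx] using hlim

theorem tendsto_eLpNorm_kernelOp_sub_of_continuous [IsFiniteMeasure (laguerreMeasure α)]
    (hα : IsAdmissible α j) {C : ℝ}
    (hk : ∀ᶠ r in 𝓝[<] 1, IsSymmKernel (laguerreMeasure α) (modifiedProdKernel α j r) C)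
    {g : (Fin d → ℝ) → 𝕜} (hg : Continuous g) {M B : ℝ} (hM : ∀ y, ‖g y‖ ≤ M * √(y j))
    (hB : ∀ y, ‖g y‖ ≤ B) {p : ℝ≥0∞} (hp0 : p ≠ 0) (hp : p ≠ ∞) :
    Tendsto (fun r => eLpNorm (kernelOp (laguerreMeasure α) (modifiedProdKernel α j r) g - g) p
      (laguerreMeasure α)) (𝓝[<] 1) (𝓝 0) := by
  refine tendsto_eLpNorm_zero_of_norm_le (B := C * B + B) ?_ ?_ ?_ hp0 hp
  · filter_upwards [hk] with r hr
    exact (hr.aestronglyMeasurable_kernelOp hg.aestronglyMeasurable).sub hg.aestronglyMeasurable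
  · filter_upwards [hk] with r hr x
    exact (norm_sub_le _ _).trans (add_le_add (hr.norm_kernelOp_le hB x) (hB x))
  · filter_upwards [ae_laguerreMeasure_mem_posOrthant α] with x hx
    simpa using (tendsto_kernelOp_modifiedProdKernel hα hx hg hM).sub_const (g x)

theorem tendsto_eLpNorm_min_smul_sub [IsFiniteMeasure (laguerreMeasure α)] (j : Fin d)
    {g : (Fin d → ℝ) → 𝕜} (hg : Continuous g) {B : ℝ} (hB : ∀ y, ‖g y‖ ≤ B) {p : ℝ≥0∞}
    (hp0 : p ≠ 0) (hp : p ≠ ∞) :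
    Tendsto (fun n : ℕ => eLpNorm (g - fun y => min 1 (n * √(y j)) • g y) p (laguerreMeasure α))
      atTop (𝓝 0) := by
  refine tendsto_eLpNorm_zero_of_norm_le (B := B) (Eventually.of_forall fun n => ?_)
    (Eventually.of_forall fun n y => ?_) ?_ hp0 hp
  · exact Continuous.aestronglyMeasurable (by fun_prop)
  · have h0 : 0 ≤ min 1 (n * √(y j)) := by positivity
    have h1 : min 1 (n * √(y j)) ≤ 1 := min_le_left _ _
    calc ‖g y - min 1 (n * √(y j)) • g y‖ = (1 - min 1 (n * √(y j))) * ‖g y‖ := by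
          rw [← Real.norm_of_nonneg (sub_nonneg.2 h1), ← norm_smul, sub_smul, one_smul]
      _ ≤ B := (mul_le_of_le_one_left (norm_nonneg _) (by linarith)).trans (hB y)
  · filter_upwards [ae_laguerreMeasure_mem_posOrthant α] with y hy
    have hs : 0 < √(y j) := Real.sqrt_pos.2 (hy j)
    obtain ⟨N, hN⟩ := exists_nat_ge (√(y j))⁻¹
    refine tendsto_const_nhds.congr' ?_
    filter_upwards [eventually_ge_atTop N] with n hn
    have hcutoff : 1 ≤ n * √(y j) :=
      (inv_le_iff_one_le_mul₀ hs).1 (hN.trans (by exact_mod_cast hn))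
    simp [min_eq_left hcutoff]

theorem exists_continuous_norm_le_sqrt_eLpNorm_sub_le [IsFiniteMeasure (laguerreMeasure α)]
    (j : Fin d) {p : ℝ≥0∞} (hp1 : 1 ≤ p) (hp : p ≠ ∞) {f : (Fin d → ℝ) → 𝕜}
    (hf : MemLp f p (laguerreMeasure α)) {ε : ℝ≥0∞} (hε : ε ≠ 0) :
    ∃ (g : (Fin d → ℝ) → 𝕜) (M B : ℝ), Continuous g ∧ (∀ y, ‖g y‖ ≤ M * √(y j)) ∧
      (∀ y, ‖g y‖ ≤ B) ∧ eLpNorm (f - g) p (laguerreMeasure α) ≤ ε := by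
  have hε2 : ε / 2 ≠ 0 := (ENNReal.half_pos hε).ne'
  obtain ⟨g, hfg, hg⟩ := hf.exists_boundedContinuous_eLpNorm_sub_le hp hε2
  obtain ⟨n, hn⟩ := (ENNReal.tendsto_nhds_zero.1 (tendsto_eLpNorm_min_smul_sub (α := α) j
    g.continuous g.norm_coe_le_norm (zero_lt_one.trans_le hp1).ne' hp) (ε / 2) hε2.bot_lt).exists
  have hnorm (y : Fin d → ℝ) : ‖min 1 (n * √(y j)) • g y‖ = min 1 (n * √(y j)) * ‖g y‖ := by
    rw [norm_smul, Real.norm_of_nonneg (by positivity)]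
  have hcont : Continuous fun y : Fin d → ℝ => min 1 (n * √(y j)) • g y := by fun_prop
  refine ⟨_, n * ‖g‖, ‖g‖, hcont, fun y => ?_, fun y => ?_, ?_⟩
  · rw [hnorm, mul_right_comm]
    gcongr
    exacts [min_le_right _ _, g.norm_coe_le_norm y]
  · rw [hnorm]
    exact (mul_le_of_le_one_left (norm_nonneg _) (min_le_left _ _)).trans (g.norm_coe_le_norm y)
  · rw [← sub_add_sub_cancel f g, ← ENNReal.add_halves ε]
    exact (eLpNorm_add_le (hf.1.sub hg.1) (hg.1.sub hcont.aestronglyMeasurable) hp1).trans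
      (add_le_add hfg hn)

theorem tendsto_eLpNorm_kernelOp_modifiedProdKernel_sub [IsFiniteMeasure (laguerreMeasure α)]
    (hα : IsAdmissible α j) {C : ℝ}
    (hk : ∀ᶠ r in 𝓝[<] 1, IsSymmKernel (laguerreMeasure α) (modifiedProdKernel α j r) C)
    {p : ℝ≥0∞} (hp1 : 1 ≤ p) (hp : p ≠ ∞) {f : (Fin d → ℝ) → 𝕜}
    (hf : MemLp f p (laguerreMeasure α)) :
    Tendsto (fun r => eLpNorm (kernelOp (laguerreMeasure α) (modifiedProdKernel α j r) f - f) p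
      (laguerreMeasure α)) (𝓝[<] 1) (𝓝 0) := by
  refine IsSymmKernel.tendsto_eLpNorm_kernelOp_sub_of_approx hk hp1 hf fun ε hε => ?_
  obtain ⟨g, M, B, hg, hM, hB, hfg⟩ := exists_continuous_norm_le_sqrt_eLpNorm_sub_le j hp1 hp hf hε
  exact ⟨g, MemLp.of_bound hg.aestronglyMeasurable B (ae_of_all _ hB), hfg,
    tendsto_eLpNorm_kernelOp_sub_of_continuous hα hk hg hM hB (zero_lt_one.trans_le hp1).ne' hp⟩

end StrongContinuity

/-! ### Semigroups of kernel operators -/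

section KernelSemigroups

variable {X : Type*} [MeasurableSpace X] {μ : Measure X} {𝕜 : Type*} [RCLike 𝕜]
  {k : X → X → ℝ} {C : ℝ}

theorem LpNormLE.congr {A B : (X → 𝕜) → (X → 𝕜)} {p : ℝ≥0∞} {c : ℝ} (hB : LpNormLE μ B p c)
    (hAB : ∀ f, A f =ᵐ[μ] B f) : LpNormLE μ A p c := fun f hf => by
  rw [memLp_congr_ae (hAB f), eLpNorm_congr_ae (hAB f)]
  exact hB f hf

theorem lpNormLE_id (p : ℝ≥0∞) : LpNormLE μ (id : (X → 𝕜) → (X → 𝕜)) p 1 := fun f hf => by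
  simpa using hf

theorem InL1AddLinfty.aestronglyMeasurable {f : X → 𝕜} (hf : InL1AddLinfty μ f) :
    AEStronglyMeasurable f μ := by
  obtain ⟨g, h, hg, hh, rfl⟩ := hf
  exact hg.1.add hh.1

theorem isLinearOnL1AddLinfty_id : IsLinearOnL1AddLinfty μ (id : (X → 𝕜) → (X → 𝕜)) where
  measurable _ hf := hf.aestronglyMeasurable
  congr _ _ _ _ hfg := hfg
  add _ _ _ _ := ae_eq_rfl
  smul _ _ _ := ae_eq_rfl

theorem IsLinearOnL1AddLinfty.congr_ae {A B : (X → 𝕜) → (X → 𝕜)}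
    (hB : IsLinearOnL1AddLinfty μ B) (hAB : ∀ f, A f =ᵐ[μ] B f) : IsLinearOnL1AddLinfty μ A where
  measurable f hf := (hB.measurable f hf).congr (hAB f).symm
  congr f g hf hg hfg := (hAB f).trans ((hB.congr f g hf hg hfg).trans (hAB g).symm)
  add f g hf hg := (hAB _).trans ((hB.add f g hf hg).trans ((hAB f).add (hAB g)).symm)
  smul c f hf := (hAB _).trans ((hB.smul c f hf).trans ((hAB f).const_smul c).symm)

theorem kernelOp_congr_ae (k : X → X → ℝ) {f g : X → 𝕜} (hfg : f =ᵐ[μ] g) :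
    kernelOp μ k f = kernelOp μ k g :=
  funext fun _ => integral_congr_ae (hfg.mono fun y hy => by simp only [hy])

theorem kernelOp_smul (k : X → X → ℝ) (c : 𝕜) (f : X → 𝕜) :
    kernelOp μ k (c • f) = c • kernelOp μ k f := by
  ext x
  simp only [kernelOp, Pi.smul_apply, mul_smul_comm, integral_smul]

theorem kernelOp_ofReal (k : X → X → ℝ) (w : X → ℝ) (x : X) :
    kernelOp μ k (fun y => (w y : 𝕜)) x = ((∫ y, k x y * w y ∂μ : ℝ) : 𝕜) := by
  simp only [kernelOp, ← integral_ofReal, RCLike.ofReal_mul]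

theorem kernelOp_one (k : X → X → ℝ) (x : X) :
    kernelOp μ k (fun _ => (1 : 𝕜)) x = ((∫ y, k x y ∂μ : ℝ) : 𝕜) := by
  simpa only [RCLike.ofReal_one, mul_one] using kernelOp_ofReal (𝕜 := 𝕜) k (fun _ => 1) x

theorem kernelOp_indicator_one (k : X → X → ℝ) {S : Set X} (hS : MeasurableSet S) (x : X) :
    kernelOp μ k (S.indicator fun _ => (1 : 𝕜)) x = ((∫ y in S, k x y ∂μ : ℝ) : 𝕜) := by
  rw [← integral_ofReal, ← integral_indicator hS, kernelOp]
  congr 1 with y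
  by_cases hy : y ∈ S <;> simp [hy]

namespace IsSymmKernel

theorem kernelOp_nonneg (hk : IsSymmKernel μ k C) {f : X → 𝕜} (hf : ∀ᵐ y ∂μ, 0 ≤ f y) (x : X) :
    0 ≤ kernelOp μ k f x :=
  integral_nonneg_of_ae (hf.mono fun y hy => mul_nonneg (RCLike.ofReal_nonneg.2 (hk.nonneg x y)) hy)

theorem isLinearOnL1AddLinfty_kernelOp [SFinite μ] (hk : IsSymmKernel μ k C) :
    IsLinearOnL1AddLinfty μ (kernelOp (𝕜 := 𝕜) μ k) where
  measurable _ hf := hk.aestronglyMeasurable_kernelOp hf.aestronglyMeasurable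
  congr _ _ _ _ hfg := (kernelOp_congr_ae k hfg).eventuallyEq
  add f g hf hg := Eq.eventuallyEq <| funext fun x => by
    simp only [kernelOp, Pi.add_apply, mul_add]
    exact integral_add (hk.integrable_mul_of_inL1AddLinfty x hf)
      (hk.integrable_mul_of_inL1AddLinfty x hg)
  smul c f _ := (kernelOp_smul k c f).eventuallyEq

theorem ae_setIntegral_le_one (hk : IsSymmKernel μ k C) {S : Set X} (hS : MeasurableSet S)
    (hcontr : eLpNorm (kernelOp μ k (S.indicator fun _ => (1 : 𝕜))) ∞ μ ≤
      eLpNorm (S.indicator fun _ => (1 : 𝕜)) ∞ μ) : ∀ᵐ x ∂μ, ∫ y in S, k x y ∂μ ≤ 1 := by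
  have hnorm : eLpNorm (S.indicator fun _ => (1 : 𝕜)) ∞ μ ≤ 1 :=
    (eLpNormEssSup_indicator_const_le S 1).trans_eq (by simp)
  filter_upwards [ae_le_eLpNormEssSup (f := kernelOp μ k (S.indicator fun _ => (1 : 𝕜))) (μ := μ)]
    with x hx
  rw [kernelOp_indicator_one k hS, ← ofReal_norm, RCLike.norm_ofReal,
    abs_of_nonneg (integral_nonneg (hk.nonneg x))] at hx
  exact ENNReal.ofReal_le_one.1 (hx.trans (hcontr.trans hnorm))

theorem ae_integral_le_one [SigmaFinite μ] (hk : IsSymmKernel μ k C)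
    (hcontr : ∀ f : X → 𝕜, MemLp f 2 μ → MemLp f ∞ μ →
      eLpNorm (kernelOp μ k f) ∞ μ ≤ eLpNorm f ∞ μ) : ∀ᵐ x ∂μ, ∫ y, k x y ∂μ ≤ 1 := by
  have hmemLp (p : ℝ≥0∞) (n : ℕ) :
      MemLp ((spanningSets μ n).indicator fun _ => (1 : 𝕜)) p μ :=
    memLp_indicator_const p (measurableSet_spanningSets μ n) 1
      (Or.inr (measure_spanningSets_lt_top μ n).ne)
  have hle : ∀ᵐ x ∂μ, ∀ n, ∫ y in spanningSets μ n, k x y ∂μ ≤ 1 := ae_all_iff.2 fun n =>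
    hk.ae_setIntegral_le_one (measurableSet_spanningSets μ n) (hcontr _ (hmemLp 2 n) (hmemLp ∞ n))
  filter_upwards [hle] with x hx
  have hlim := tendsto_setIntegral_of_monotone (measurableSet_spanningSets μ)
    (monotone_spanningSets μ) (hk.integrable x).integrableOn
  rw [iUnion_spanningSets, Measure.restrict_univ] at hlim
  exact le_of_tendsto' hlim hx

end IsSymmKernel

variable {T : ℝ → (X → 𝕜) → (X → 𝕜)} {k : ℝ → X → X → ℝ}

theorem isSymmetricDiffusionSemigroup_of_ae_eq_kernelOp [SFinite μ] (hT₀ : T 0 = id)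
    (hT : ∀ t, 0 < t → ∀ f, T t f =ᵐ[μ] kernelOp μ (k t) f)
    (hk : ∀ t, 0 < t → IsSymmKernel μ (k t) 1)
    (hsemigroup : ∀ s t, 0 < s → 0 < t → ∀ x z,
      HasBochnerIntegral (fun y => k s x y * k t y z) μ (k (s + t) x z))
    (hcont : ∀ f : X → 𝕜, MemLp f 2 μ →
      Tendsto (fun t => eLpNorm (kernelOp μ (k t) f - f) 2 μ) (𝓝[>] 0) (𝓝 0)) :
    IsSymmetricDiffusionSemigroup μ T where
  linear t ht := by
    rcases ht.eq_or_lt with rfl | ht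
    · exact hT₀ ▸ isLinearOnL1AddLinfty_id
    · exact (hk t ht).isLinearOnL1AddLinfty_kernelOp.congr_ae (hT t ht)
  zero f _ := by rw [hT₀, id]
  contraction p hp t ht := by
    rcases ht.eq_or_lt with rfl | ht
    · exact hT₀ ▸ lpNormLE_id p
    · exact ((hk t ht).lpNormLE_kernelOp hp).congr (hT t ht)
  semigroup p hp s t hs ht f hf := by
    rcases hs.eq_or_lt with rfl | hs
    · rw [zero_add, hT₀, id]
    rcases ht.eq_or_lt with rfl | ht
    · rw [add_zero, hT₀, id]
    filter_upwards [hT (s + t) (add_pos hs ht) f, hT s hs (T t f)] with x hst hs'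
    rw [hst, hs', kernelOp_congr_ae (k s) (hT t ht f)]
    exact (hk s hs).kernelOp_comp (hk t ht) (hk (s + t) (add_pos hs ht))
      (hsemigroup s t hs ht x) hp hf
  selfAdjoint t ht f g hf hg := by
    rcases ht.eq_or_lt with rfl | ht
    · rw [hT₀, id, id]
    · have hleft : (fun x => inner 𝕜 (T t f x) (g x)) =ᵐ[μ]
          fun x => inner 𝕜 (kernelOp μ (k t) f x) (g x) :=
        (hT t ht f).mono fun x hx => by simp only [hx]
      have hright : (fun x => inner 𝕜 (f x) (T t g x)) =ᵐ[μ]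
          fun x => inner 𝕜 (f x) (kernelOp μ (k t) g x) :=
        (hT t ht g).mono fun x hx => by simp only [hx]
      rw [integral_congr_ae hleft, integral_congr_ae hright,
        (hk t ht).integral_inner_kernelOp hf hg]
  continuous f hf := (hcont f hf).congr' <| eventually_mem_nhdsWithin.mono fun t ht =>
    eLpNorm_congr_ae ((hT t ht f).symm.sub ae_eq_rfl)

theorem isPositiveFamily_of_ae_eq_kernelOp (hT₀ : T 0 = id)
    (hT : ∀ t, 0 < t → ∀ f, T t f =ᵐ[μ] kernelOp μ (k t) f)
    (hk : ∀ t, 0 < t → IsSymmKernel μ (k t) C) : IsPositiveFamily μ T := by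
  intro t ht f _ hf
  rcases ht.eq_or_lt with rfl | ht
  · rwa [hT₀]
  · filter_upwards [hT t ht f] with x hx
    exact hx ▸ (hk t ht).kernelOp_nonneg hf x

theorem ae_one_le_one_of_ae_eq_kernelOp (hT₀ : T 0 = id)
    (hT : ∀ t, 0 < t → ∀ f, T t f =ᵐ[μ] kernelOp μ (k t) f)
    (hk : ∀ t, 0 < t → IsSymmKernel μ (k t) 1) {t : ℝ} (ht : 0 ≤ t) :
    ∀ᵐ x ∂μ, T t (fun _ => 1) x ≤ 1 := by
  rcases ht.eq_or_lt with rfl | ht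
  · exact hT₀ ▸ ae_of_all _ fun _ => le_rfl
  · filter_upwards [hT t ht fun _ => 1] with x hx
    rw [hx, kernelOp_one, ← RCLike.ofReal_one, RCLike.ofReal_le_ofReal]
    exact (hk t ht).integral_le x

end KernelSemigroups

/-! ### The modified Laguerre semigroup -/

section ModifiedSemigroup

variable {d : ℕ} {α : Fin d → ℝ} {j : Fin d} {𝕜 : Type*} [RCLike 𝕜]

theorem exp_neg_lt_one {t : ℝ} (ht : 0 < t) : Real.exp (-t) < 1 :=
  Real.exp_lt_one_iff.2 (neg_lt_zero.2 ht)

theorem tendsto_exp_neg_nhdsGT_zero :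
    Tendsto (fun t : ℝ => Real.exp (-t)) (𝓝[>] 0) (𝓝[<] 1) := by
  refine tendsto_nhdsWithin_iff.2
    ⟨?_, eventually_mem_nhdsWithin.mono fun t ht => exp_neg_lt_one ht⟩
  have hcont : Continuous fun t : ℝ => Real.exp (-t) := by fun_prop
  simpa only [neg_zero, Real.exp_zero] using (hcont.tendsto 0).mono_left nhdsWithin_le_nhds

theorem isSymmKernel_modifiedProdKernel_exp (hα : IsAdmissible α j) {t c : ℝ} (ht : 0 < t)
    (hc : ∀ z, 0 ≤ z → modifiedMass (α j + 1) z ≤ c) :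
    IsSymmKernel (laguerreMeasure α) (modifiedProdKernel α j (Real.exp (-t)))
      (c * Real.exp (-t / 2)) := by
  rw [Real.exp_half, mul_comm]
  exact isSymmKernel_modifiedProdKernel hα (Real.exp_pos _) (exp_neg_lt_one ht) hc

theorem lpNormLE_modifiedSemigroup (hα : IsAdmissible α j) {t c : ℝ} (ht : 0 < t)
    (hc : ∀ z, 0 ≤ z → modifiedMass (α j + 1) z ≤ c) {p : ℝ≥0∞} (hp : 1 ≤ p) :
    LpNormLE (laguerreMeasure α) (modifiedSemigroup 𝕜 α j t) p (c * Real.exp (-t / 2)) :=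
  ((isSymmKernel_modifiedProdKernel_exp hα ht hc).lpNormLE_kernelOp hp).congr
    (modifiedSemigroup_ae_eq hα ht)

theorem integrable_modifiedKernel_mul (hα : IsAdmissible α j) {t : ℝ} (ht : 0 < t)
    {x : Fin d → ℝ} (hx : x ∈ posOrthant d) {f : (Fin d → ℝ) → 𝕜}
    (hf : InL1AddLinfty (laguerreMeasure α) f) :
    Integrable (fun y => (modifiedKernel α j t x y : 𝕜) * f y) (laguerreMeasure α) := by
  have hk := isSymmKernel_modifiedProdKernel_exp hα ht
    fun z hz => modifiedMass_le (by linarith [hα.1]) hz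
  refine (hk.integrable_mul_of_inL1AddLinfty x hf).congr ?_
  filter_upwards [ae_laguerreMeasure_mem_posOrthant α] with y hy
  rw [modifiedKernel_eq_modifiedProdKernel hα ht hx hy]

theorem modifiedSemigroup_zero : modifiedSemigroup 𝕜 α j 0 = id :=
  funext fun _ => if_pos rfl

theorem isSymmKernel_modifiedProdKernel_exp_one (hα : IsAdmissible α j) (hj : -1 / 2 ≤ α j)
    {t : ℝ} (ht : 0 < t) :
    IsSymmKernel (laguerreMeasure α) (modifiedProdKernel α j (Real.exp (-t))) 1 :=
  (isSymmKernel_modifiedProdKernel_exp hα ht fun z hz =>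
    modifiedMass_le_one (by linarith) hz).mono (by
      rw [one_mul, Real.exp_le_one_iff]
      linarith)

theorem tendsto_eLpNorm_kernelOp_modifiedProdKernel_exp_sub (hα : IsAdmissible α j)
    (hj : -1 / 2 ≤ α j) {f : (Fin d → ℝ) → 𝕜} (hf : MemLp f 2 (laguerreMeasure α)) :
    Tendsto (fun t => eLpNorm (kernelOp (laguerreMeasure α)
      (modifiedProdKernel α j (Real.exp (-t))) f - f) 2 (laguerreMeasure α)) (𝓝[>] 0) (𝓝 0) := by
  have hα' (i : Fin d) : -1 < α i := by
    rcases eq_or_ne i j with rfl | hij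
    exacts [by linarith, hα.2 i hij]
  have : IsFiniteMeasure (laguerreMeasure α) := isFiniteMeasure_laguerreMeasure hα'
  have hk : ∀ᶠ r in 𝓝[<] 1, IsSymmKernel (laguerreMeasure α) (modifiedProdKernel α j r) 1 := by
    filter_upwards [Ioo_mem_nhdsLT zero_lt_one] with r hr
    simpa only [neg_neg, Real.exp_log hr.1] using isSymmKernel_modifiedProdKernel_exp_one hα hj
      (neg_pos.2 (Real.log_neg hr.1 hr.2))
  exact (tendsto_eLpNorm_kernelOp_modifiedProdKernel_sub hα hk one_le_two (by finiteness) hf).comp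
    tendsto_exp_neg_nhdsGT_zero

theorem isSymmetricDiffusionSemigroup_modifiedSemigroup (hα : IsAdmissible α j)
    (hj : -1 / 2 ≤ α j) :
    IsSymmetricDiffusionSemigroup (laguerreMeasure α) (modifiedSemigroup 𝕜 α j) := by
  refine isSymmetricDiffusionSemigroup_of_ae_eq_kernelOp modifiedSemigroup_zero
    (fun t ht => modifiedSemigroup_ae_eq hα ht)
    (fun t ht => isSymmKernel_modifiedProdKernel_exp_one hα hj ht) (fun s t hs ht x z => ?_)
    (fun f hf => tendsto_eLpNorm_kernelOp_modifiedProdKernel_exp_sub hα hj hf)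
  rw [neg_add, Real.exp_add]
  exact hasBochnerIntegral_modifiedProdKernel_mul_modifiedProdKernel hα (Real.exp_pos _).le
    (exp_neg_lt_one hs) (Real.exp_pos _).le (exp_neg_lt_one ht) x z

theorem isSubmarkovian_modifiedSemigroup (hα : IsAdmissible α j) (hj : -1 / 2 ≤ α j) :
    IsSubmarkovian (laguerreMeasure α) (modifiedSemigroup 𝕜 α j) := by
  have hT (t : ℝ) (ht : 0 < t) (f : (Fin d → ℝ) → 𝕜) := modifiedSemigroup_ae_eq hα ht f
  have hk (t : ℝ) (ht : 0 < t) := isSymmKernel_modifiedProdKernel_exp_one hα hj ht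
  exact ⟨isSymmetricDiffusionSemigroup_modifiedSemigroup hα hj,
    isPositiveFamily_of_ae_eq_kernelOp modifiedSemigroup_zero hT hk,
    fun _ ht => ae_one_le_one_of_ae_eq_kernelOp modifiedSemigroup_zero hT hk ht⟩

theorem not_isMarkovian_modifiedSemigroup (hα : IsAdmissible α j) (hj : -1 / 2 ≤ α j) :
    ¬ IsMarkovian (laguerreMeasure α) (modifiedSemigroup 𝕜 α j) := by
  rintro ⟨-, -, hone⟩
  obtain ⟨x, hx, hTx⟩ := exists_mem_of_ae_laguerreMeasure (hone 1 zero_le_one)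
    (isOpen_posOrthant d) ⟨1, fun _ => one_pos, fun _ => one_pos⟩
  have hk := isSymmKernel_modifiedProdKernel_exp hα one_pos fun z hz =>
    modifiedMass_le_one (b := α j + 1) (by linarith) hz
  rw [modifiedSemigroup_eq_kernelOp hα (zero_lt_one' ℝ) _ hx, kernelOp_one] at hTx
  have hmass := RCLike.ofReal_inj.1 (hTx.trans RCLike.ofReal_one.symm)
  have hlt : Real.exp (-1 / 2) < 1 := Real.exp_lt_one_iff.2 (by norm_num)
  linarith [hk.integral_le x]

theorem exists_isOpen_one_lt_integral_modifiedProdKernel (hα : IsAdmissible α j)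
    (hj : α j < -1 / 2) :
    ∃ t : ℝ, 0 < t ∧ ∃ U : Set (Fin d → ℝ), IsOpen U ∧ (U ∩ posOrthant d).Nonempty ∧
      ∀ x ∈ U, 1 < ∫ y, modifiedProdKernel α j (Real.exp (-t)) x y ∂laguerreMeasure α := by
  obtain ⟨κ, p, hκ, hp, hmass⟩ := exists_one_lt_modifiedMass (b := α j + 1)
    (by linarith [hα.1]) (by linarith)
  have hlog : 0 < Real.log κ := Real.log_pos hκ
  set r := Real.exp (-Real.log κ) with hr
  have hr0 : 0 < r := Real.exp_pos _
  have hr1 : 0 < 1 - r := sub_pos.2 (exp_neg_lt_one hlog)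
  have hcont : Continuous fun x : Fin d → ℝ => r * |x j| / (1 - r) := by fun_prop
  have hpos : 0 < (p + 1 / 2) * (1 - r) / r := by positivity
  have hcentre : r * |(p + 1 / 2) * (1 - r) / r| / (1 - r) = p + 1 / 2 := by
    rw [abs_of_pos hpos]
    field_simp
  refine ⟨Real.log κ, hlog, _, (isOpen_Ioo (a := p) (b := p + 1)).preimage hcont,
    ⟨fun _ => (p + 1 / 2) * (1 - r) / r, ?_, fun _ => hpos⟩, fun x hx => ?_⟩
  · rw [Set.mem_preimage, hcentre]
    constructor <;> linarith
  · have hgrowth : √r * κ = Real.exp (Real.log κ / 2) := by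
      rw [hr, ← Real.exp_half, ← Real.exp_log (zero_lt_one.trans hκ), ← Real.exp_add,
        Real.log_exp]
      ring_nf
    rw [(hasBochnerIntegral_modifiedProdKernel hα hr0.le (sub_pos.1 hr1) x).2]
    calc 1 < √r * κ := hgrowth ▸ Real.one_lt_exp_iff.2 (half_pos hlog)
      _ ≤ _ := mul_le_mul_of_nonneg_left (hmass _ hx) (Real.sqrt_nonneg r)

theorem not_isLpContractive_modifiedSemigroup (hα : IsAdmissible α j) (hj : α j < -1 / 2) :
    ¬ IsLpContractive (laguerreMeasure α) (modifiedSemigroup 𝕜 α j) := by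
  intro hcontr
  obtain ⟨t, ht, U, hU, hne, hlt⟩ := exists_isOpen_one_lt_integral_modifiedProdKernel hα hj
  have hk := isSymmKernel_modifiedProdKernel_exp hα ht
    fun z hz => modifiedMass_le (by linarith [hα.1]) hz
  have hle := hk.ae_integral_le_one (𝕜 := 𝕜) fun f hf2 hf => by
    rw [← eLpNorm_congr_ae (modifiedSemigroup_ae_eq hα ht f)]
    exact hcontr ∞ le_top t ht.le f hf2 hf
  obtain ⟨x, hx, hx1⟩ := exists_mem_of_ae_laguerreMeasure hle hU hne
  exact (hlt x hx).not_ge hx1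

end ModifiedSemigroup

theorem mainTheorem4 (𝕜 : Type*) [RCLike 𝕜] (d : ℕ) (j : Fin d) (α : Fin d → ℝ)
    (hα : IsAdmissible α j) :
    (∀ t : ℝ, 0 < t → ∀ x ∈ posOrthant d, ∀ f : (Fin d → ℝ) → 𝕜,
      InL1AddLinfty (laguerreMeasure α) f →
        Integrable (fun y => (modifiedKernel α j t x y : 𝕜) * f y) (laguerreMeasure α)) ∧
    (-1 / 2 ≤ α j →
      IsSubmarkovian (laguerreMeasure α) (modifiedSemigroup 𝕜 α j) ∧
      ¬ IsMarkovian (laguerreMeasure α) (modifiedSemigroup 𝕜 α j) ∧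
      ∀ p : ℝ≥0∞, 1 ≤ p → ∀ t : ℝ, 0 < t →
        LpNormLE (laguerreMeasure α) (modifiedSemigroup 𝕜 α j t) p (Real.exp (-t / 2))) ∧
    (α j < -1 / 2 →
      ¬ IsLpContractive (laguerreMeasure α) (modifiedSemigroup 𝕜 α j) ∧
      ∃ c : ℝ, 1 < c ∧ ∀ p : ℝ≥0∞, 1 ≤ p → ∀ t : ℝ, 0 < t →
        LpNormLE (laguerreMeasure α) (modifiedSemigroup 𝕜 α j t) p
          (c * Real.exp (-t / 2))) := by
  have hb : -1 / 2 < α j + 1 := by linarith [hα.1]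
  refine ⟨fun t ht x hx f hf => integrable_modifiedKernel_mul hα ht hx hf, fun hj => ?_,
    fun hj => ?_⟩
  · refine ⟨isSubmarkovian_modifiedSemigroup hα hj, not_isMarkovian_modifiedSemigroup hα hj,
      fun p hp t ht => ?_⟩
    simpa using lpNormLE_modifiedSemigroup (𝕜 := 𝕜) hα ht
      (fun z hz => modifiedMass_le_one (by linarith) hz) hp
  · refine ⟨not_isLpContractive_modifiedSemigroup hα hj,
      (α j + 1 + 1) / (α j + 1 + 1 / 2), ?_, fun p hp t ht =>
        lpNormLE_modifiedSemigroup hα ht (fun z hz => modifiedMass_le hb hz) hp⟩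
    rw [one_lt_div (by linarith)]
    linarith
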